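/- For a finite nonzero measure $\alpha$ on $\mathbb{R}$ let $\mathcal{D}_\alpha$ be the law, on the space of probability measures on $\mathbb{R}$, of the Dirichlet process with parameter $\alpha$: for every finite measurable partition $C_1,\dots,C_{n+1}$ of $\mathbb{R}$, the random vector $(\varphi(C_1),\dots,\varphi(C_n))$ has, under $\mathcal{D}_\alpha(d\varphi)$, the Dirichlet distribution with parameter $(\alpha(C_1),\dots,\alpha(C_{n+1}))$, a zero parameter meaning that the corresponding coordinate vanishes almost surely. Let $$\mathbb{F}_1=\Big\{\alpha:\ \alpha(\mathbb{R})=1,\ \int_{\mathbb{R}}\log(1+|x|)\,\alpha(dx)<\infty\Big\},$$ let $\mu_\alpha$, for $\alpha\in\mathbb{F}_1$, be the law of the mean $\int x\,\varphi(dx)$ under $\mathcal{D}_\alpha(d\varphi)$, and let $\mathbb{M}_1=\{\mu_\alpha:\alpha\in\mathbb{F}_1\}$. For $\theta\in\mathbb{R}$ and $\sigma\in(0,\infty)$ let $$C_{\theta,\sigma^2}(dx)=\frac{\sigma}{\pi\,(1+\sigma^2(x-\theta)^2)}\,dx$$ be the Cauchy distribution, and let $C_{\theta,+\infty}=\delta_\theta$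 be the point mass at $\theta$. **Theorem 5.** The Markov–Krein correspondence $\beta_1:\mu_\alpha\mapsto\alpha$ is a well-defined bijection of $\mathbb{M}_1$ onto $\mathbb{F}_1$, and the class of all its fixed points is $$\{C_{\theta,\sigma^2}:\theta\in\mathbb{R},\ \sigma^2\in(0,+\infty]\}.$$ In other terms, for every $\alpha\in\mathbb{F}_1$, $\mu_\alpha=\alpha$ if and only if $\alpha$ is a Cauchy distribution or a point mass. -/

import Mathlib

open MeasureTheory ProbabilityTheory
open scoped NNReal ENNReal

noncomputable section

namespace DirichletMean

/-- The open simplex `T_n = {u ∈ ℝⁿ : u_i > 0 for every i, u_1 + ⋯ + u_n < 1}`. -/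
def openSimplex (n : ℕ) : Set (Fin n → ℝ) :=
  {u | (∀ i, 0 < u i) ∧ ∑ i, u i < 1}

/-- The density on `ℝⁿ` of the Dirichlet distribution with parameter
`(b_1, …, b_n, b_{n+1})`, all `b_k > 0`. -/
def dirichletPDFReal {n : ℕ} (b : Fin (n + 1) → ℝ) (u : Fin n → ℝ) : ℝ :=
  (openSimplex n).indicator
    (fun u => Real.Gamma (∑ i, b i) / (∏ i, Real.Gamma (b i)) *
      ((∏ i : Fin n, u i ^ (b i.castSucc - 1)) * (1 - ∑ i, u i) ^ (b (Fin.last n) - 1))) u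

/-- The Dirichlet distribution on `ℝⁿ` with parameter `(b_1, …, b_n, b_{n+1})`, all `b_k > 0`. -/
def dirichletMeasure {n : ℕ} (b : Fin (n + 1) → ℝ) : Measure (Fin n → ℝ) :=
  (volume : Measure (Fin n → ℝ)).withDensity fun u => ENNReal.ofReal (dirichletPDFReal b u)

/-- `D`, a probability on the space of all probability measures on `ℝ`, is the functional
Dirichlet distribution with parameter the finite nonzero measure `α`: for each finite measurable
partition `C_1, …, C_{n+1}` of `ℝ`, the vector `(φ(C_1), …, φ(C_n))` is Dirichlet distributed
with parameter `(α(C_1), …, α(C_{n+1}))` under `D(dφ)`. As usual, a zero parameter means that the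
corresponding coordinate vanishes almost surely. -/
structure IsDirichletProcess (α : Measure ℝ) (D : Measure (ProbabilityMeasure ℝ)) : Prop where
  isProbabilityMeasure : IsProbabilityMeasure D
  map_partition : ∀ (n : ℕ) (C : Fin (n + 1) → Set ℝ), (∀ i, MeasurableSet (C i)) →
    Pairwise (fun i j => Disjoint (C i) (C j)) → (⋃ i, C i) = Set.univ →
    (∀ i, α (C i) ≠ 0) →
    D.map (fun φ : ProbabilityMeasure ℝ => fun i : Fin n => (φ : Measure ℝ).real (C i.castSucc)) =
      dirichletMeasure fun i => α.real (C i)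
  ae_null : ∀ N : Set ℝ, MeasurableSet N → α N = 0 → ∀ᵐ φ : ProbabilityMeasure ℝ ∂D, (φ : Measure ℝ) N = 0

open Classical in
/-- The functional Dirichlet distribution `D_α` with parameter `α` (a finite nonzero measure). -/
def dirichletProcess (α : Measure ℝ) : Measure (ProbabilityMeasure ℝ) :=
  if h : ∃ D, IsDirichletProcess α D then h.choose else 0

/-- `μ_α`, the law of the mean `φ(I) = ∫ x φ(dx)` under `D_α(dφ)`. -/
def meanLaw (α : Measure ℝ) : Measure ℝ :=
  (dirichletProcess α).map fun φ : ProbabilityMeasure ℝ => ∫ x, x ∂(φ : Measure ℝ)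

/-- `𝔽_a`: the measures on `ℝ` of total mass `a` that integrate `log (1 + |x|)`. -/
def paramClass (a : ℝ) : Set (Measure ℝ) :=
  {α | α Set.univ = ENNReal.ofReal a ∧ ∫⁻ x, ENNReal.ofReal (Real.log (1 + |x|)) ∂α < ⊤}

/-- `𝕄_a`: the laws `μ_α` with `α ∈ 𝔽_a`. -/
def meanLawClass (a : ℝ) : Set (Measure ℝ) :=
  meanLaw '' paramClass a

/-- The Markov–Krein correspondence `β_a`, which sends `μ_α ∈ 𝕄_a` to `α ∈ 𝔽_a`. -/
def markovKrein (a : ℝ) : Measure ℝ → Measure ℝ :=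
  Function.invFunOn meanLaw (paramClass a)

open Classical in
/-- `C_{θ, v}` for `v = σ² ∈ (0, ∞]`: for `σ < ∞` the Cauchy law with location `θ` and scale
`1 / σ`, that is, with density `σ / (π (1 + σ² (x - θ)²))`; for `σ = ∞` the point mass at `θ`. -/
def cauchyLaw (θ : ℝ) (v : ℝ≥0∞) : Measure ℝ :=
  if v = ⊤ then Measure.dirac θ else cauchyMeasure θ (NNReal.sqrt v.toNNReal)⁻¹

end DirichletMean

end

/-! For a law `μ` put `S_μ(w) = ∫ (w + ix)⁻¹ dμ` and `Λ_μ(w) = ∫ log (w + ix) dμ` on `Re w > 0`, so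
that `Λ_μ' = S_μ`. Everything rests on the Markov–Krein identity `S_{μ_α} = exp (-Λ_α)`
(`stieltjesRight_meanLaw`).

Injectivity of `α ↦ μ_α`: the identity recovers `exp Λ_α`, whose logarithmic derivative is `S_α`,
and Stieltjes inversion (`ext_of_stieltjesRight`) recovers `α`. Fixed points: if `μ_α = α`, then
`(exp Λ_α)' = exp Λ_α · S_α = 1`, so `exp Λ_α = w + c` and `S_α = 1 / (w + c)`. Since `exp` has no
zero, `Re c ≥ 0`, and this is the transform of the Cauchy law with location `Im c` and scale `Re c`,
a point mass when the scale is zero. Conversely `S = 1 / (w + c)` solves `S' = -S²`, which forces `S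
= exp (-Λ)`.

The identity is proved for every process with the prescribed Dirichlet marginals, so uniqueness of
the process is not needed. On a finite partition it is a Gamma integral computed in two ways
(`integral_dirichletMeasure_cpow`); simple functions then approximate `x ↦ x`. The limit requires
that almost every realization integrate `|x|`, which follows from the same identity with a small
parameter (`IsDirichletProcess.ae_lintegral_lt_top`).

Existence comes from stick breaking with uniform sticks, the case of total mass one. Linear
functionals of the random measure solve `Z = B Y + (1 - B) Z'`, and `∫₀¹ (b q + (1 - b) p)⁻² db = 1
/ (p q)` turns this into `S_Z' = -S_Z S_Y`, hence `S_Z = exp (-Λ_Y)`. Comparison with the Dirichlet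
distribution, one linear form at a time, identifies the marginals. -/

namespace DirichletMean

/-! ### Stieltjes transform and logarithmic potential on the right half-plane. -/

open Complex Filter Topology

/-- The Cauchy–Stieltjes transform of a measure on `ℝ`, on the right half-plane. -/
noncomputable def stieltjesRight (μ : Measure ℝ) (w : ℂ) : ℂ := ∫ x : ℝ, (w + x * I)⁻¹ ∂μ

/-- The logarithmic potential of a measure on `ℝ`, on the right half-plane. -/
noncomputable def logPotential (μ : Measure ℝ) (w : ℂ) : ℂ := ∫ x : ℝ, log (w + x * I) ∂μ

lemma add_mul_I_ne_zero {w : ℂ} (hw : 0 < w.re) (x : ℝ) : w + x * I ≠ 0 := by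
  intro h
  have := congrArg re h
  simp at this
  exact hw.ne' this

lemma mem_slitPlane_of_re_pos {w : ℂ} (hw : 0 < w.re) : w ∈ slitPlane := Or.inl hw

lemma add_mul_I_mem_slitPlane {w : ℂ} (hw : 0 < w.re) (x : ℝ) : w + x * I ∈ slitPlane :=
  mem_slitPlane_of_re_pos (by simpa using hw)

lemma norm_inv_le_of_re {z : ℂ} {r : ℝ} (hr : 0 < r) (hz : r ≤ z.re) : ‖z⁻¹‖ ≤ r⁻¹ := by
  rw [norm_inv]
  exact inv_anti₀ hr (hz.trans (re_le_norm z))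

lemma norm_inv_add_mul_I_le {w : ℂ} (hw : 0 < w.re) (x : ℝ) : ‖(w + x * I)⁻¹‖ ≤ w.re⁻¹ :=
  norm_inv_le_of_re hw (by simp)

lemma integrable_inv_add_mul_I {μ : Measure ℝ} [IsFiniteMeasure μ] {w : ℂ} (hw : 0 < w.re) :
    Integrable (fun x : ℝ => (w + x * I)⁻¹) μ :=
  Integrable.of_bound (by fun_prop) w.re⁻¹ (ae_of_all _ (norm_inv_add_mul_I_le hw))

lemma norm_log_le_of_norm_le {z : ℂ} {r R : ℝ} (hr : 0 < r) (hrz : r ≤ ‖z‖) (hzR : ‖z‖ ≤ R) :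
    ‖log z‖ ≤ |Real.log r| + |Real.log R| + Real.pi := by
  have h0 : 0 < ‖z‖ := hr.trans_le hrz
  have h1 : ‖log z‖ ≤ |Real.log ‖z‖| + |z.arg| := by
    simpa [log_re, log_im] using norm_le_abs_re_add_abs_im (log z)
  have h2 := abs_arg_le_pi z
  have h3 : |Real.log ‖z‖| ≤ |Real.log r| + |Real.log R| := by
    have a := Real.log_le_log hr hrz
    have b := Real.log_le_log h0 hzR
    rw [abs_le]
    constructor
    · linarith [neg_abs_le (Real.log r), abs_nonneg (Real.log R)]
    · linarith [le_abs_self (Real.log R), abs_nonneg (Real.log r)]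
  linarith

/-- The dependence on `w` and on `x` is separated. The free majorant `B` allows one dominating
function for all rescalings or approximations of `x`. -/
lemma norm_log_add_mul_I_le {w : ℂ} (hw : 0 < w.re) {x B : ℝ} (hB : |x| ≤ B) :
    ‖log (w + x * I)‖ ≤ |Real.log w.re| + Real.log (1 + ‖w‖) + Real.pi + Real.log (1 + B) := by
  have hB0 : 0 ≤ B := (abs_nonneg x).trans hB
  have h1 : w.re ≤ ‖w + x * I‖ := by simpa using re_le_norm (w + x * I)
  have h2 : ‖w + x * I‖ ≤ (1 + ‖w‖) * (1 + B) := by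
    calc ‖w + x * I‖ ≤ ‖w‖ + |x| := by simpa using norm_add_le w (x * I)
      _ ≤ _ := by nlinarith [norm_nonneg w]
  have h3 := norm_log_le_of_norm_le hw h1 h2
  have hw1 : 1 ≤ 1 + ‖w‖ := by linarith [norm_nonneg w]
  have hB1 : 1 ≤ 1 + B := by linarith
  rw [abs_of_nonneg (Real.log_nonneg (one_le_mul_of_one_le_of_one_le hw1 hB1)),
    Real.log_mul (by positivity) (by positivity)] at h3
  linarith

lemma measurable_log_add_mul_I (w : ℂ) : Measurable fun x : ℝ => log (w + x * I) :=
  measurable_log.comp (by fun_prop)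

lemma integrable_log_add_mul_I {μ : Measure ℝ} [IsFiniteMeasure μ]
    (hμ : Integrable (fun x : ℝ => Real.log (1 + |x|)) μ) {w : ℂ} (hw : 0 < w.re) :
    Integrable (fun x : ℝ => log (w + x * I)) μ :=
  ((integrable_const (|Real.log w.re| + Real.log (1 + ‖w‖) + Real.pi)).add hμ).mono'
    (measurable_log_add_mul_I w).aestronglyMeasurable
    (ae_of_all _ fun _ => norm_log_add_mul_I_le hw le_rfl)

lemma re_pos_of_mem_ball {w z : ℂ} (hz : z ∈ Metric.ball w (w.re / 2)) : w.re / 2 ≤ z.re := by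
  have h1 : ‖z - w‖ < w.re / 2 := by simpa [dist_eq_norm] using hz
  have h2 := (abs_le.1 (abs_re_le_norm (z - w))).1
  simp at h2
  linarith

lemma hasDerivAt_logPotential {μ : Measure ℝ} [IsFiniteMeasure μ]
    (hμ : Integrable (fun x : ℝ => Real.log (1 + |x|)) μ) {w : ℂ} (hw : 0 < w.re) :
    HasDerivAt (logPotential μ) (stieltjesRight μ w) w := by
  refine (hasDerivAt_integral_of_dominated_loc_of_deriv_le (μ := μ)
    (F := fun z (x : ℝ) => log (z + x * I)) (F' := fun z (x : ℝ) => (z + x * I)⁻¹)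
    (bound := fun _ => (w.re / 2)⁻¹) (Metric.ball_mem_nhds w (half_pos hw))
    (Eventually.of_forall fun z => (measurable_log_add_mul_I z).aestronglyMeasurable)
    (integrable_log_add_mul_I hμ hw) (by fun_prop)
    ?_ (integrable_const _) ?_).2
  · refine ae_of_all _ fun x z hz => norm_inv_le_of_re (half_pos hw) ?_
    simpa using re_pos_of_mem_ball hz
  · refine ae_of_all _ fun x z hz => ?_
    have hz' : 0 < z.re := (half_pos hw).trans_le (re_pos_of_mem_ball hz)
    simpa using ((hasDerivAt_id z).add_const (x * I : ℂ)).clog (add_mul_I_mem_slitPlane hz' x)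

lemma hasDerivAt_stieltjesRight {μ : Measure ℝ} [IsFiniteMeasure μ] {w : ℂ} (hw : 0 < w.re) :
    HasDerivAt (stieltjesRight μ) (-∫ x : ℝ, (w + x * I)⁻¹ ^ 2 ∂μ) w := by
  rw [← integral_neg]
  refine (hasDerivAt_integral_of_dominated_loc_of_deriv_le (μ := μ)
    (F := fun z (x : ℝ) => (z + x * I)⁻¹) (F' := fun z (x : ℝ) => -(z + x * I)⁻¹ ^ 2)
    (bound := fun _ => (w.re / 2)⁻¹ ^ 2) (Metric.ball_mem_nhds w (half_pos hw))
    (Eventually.of_forall fun z => by fun_prop) (integrable_inv_add_mul_I hw)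
    (by fun_prop) ?_ (integrable_const _) ?_).2
  · refine ae_of_all _ fun x z hz => ?_
    rw [norm_neg, norm_pow]
    gcongr
    exact norm_inv_le_of_re (half_pos hw) (by simpa using re_pos_of_mem_ball hz)
  · refine ae_of_all _ fun x z hz => ?_
    have hz' : 0 < z.re := (half_pos hw).trans_le (re_pos_of_mem_ball hz)
    have := ((hasDerivAt_id z).add_const (x * I : ℂ)).inv (add_mul_I_ne_zero hz' x)
    refine HasDerivAt.congr_deriv this ?_
    simp [neg_div]

/-- Behaviour at infinity along the positive axis. With the next limit it fixes the constant of
integration in the differential equation for the transform. -/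
lemma tendsto_mul_stieltjesRight (μ : Measure ℝ) [IsProbabilityMeasure μ] :
    Tendsto (fun y : ℝ => y * stieltjesRight μ y) atTop (𝓝 1) := by
  have key : Tendsto (fun y : ℝ => ∫ x : ℝ, (y : ℂ) * (y + x * I)⁻¹ ∂μ) atTop
      (𝓝 (∫ _, (1 : ℂ) ∂μ)) := by
    refine tendsto_integral_filter_of_dominated_convergence (fun _ => 1)
      (Eventually.of_forall fun y => by fun_prop) ?_ (integrable_const _) ?_
    · filter_upwards [eventually_gt_atTop 0] with y hy
      refine ae_of_all _ fun x => ?_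
      have := norm_inv_add_mul_I_le (w := y) (by simpa using hy) x
      rw [norm_mul, norm_real, Real.norm_of_nonneg hy.le]
      calc y * _ ≤ y * y⁻¹ := by gcongr; simpa using this
        _ = 1 := mul_inv_cancel₀ hy.ne'
    · refine ae_of_all _ fun x => ?_
      have h1 : Tendsto (fun y : ℝ => (1 + (y⁻¹ : ℝ) * (x * I))⁻¹) atTop (𝓝 (1 : ℂ)) := by
        have h2 : Tendsto (fun y : ℝ => ((y⁻¹ : ℝ) : ℂ)) atTop (𝓝 0) := by
          exact_mod_cast (continuous_ofReal.tendsto 0).comp tendsto_inv_atTop_zero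
        have h3 := ((h2.mul_const (x * I)).const_add 1).inv₀ (by simp)
        simpa using h3
      refine h1.congr' ?_
      filter_upwards [eventually_gt_atTop 0] with y hy
      have hy' : (y : ℂ) ≠ 0 := by exact_mod_cast hy.ne'
      have h4 : (y : ℂ) + x * I = y * (1 + (y⁻¹ : ℝ) * (x * I)) := by
        push_cast; field_simp
      rw [h4, mul_inv, mul_inv_cancel_left₀ hy']
  simpa [stieltjesRight, integral_const_mul] using key

lemma tendsto_exp_logPotential_div {μ : Measure ℝ} [IsProbabilityMeasure μ]
    (hμ : Integrable (fun x : ℝ => Real.log (1 + |x|)) μ) :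
    Tendsto (fun y : ℝ => exp (logPotential μ y) / y) atTop (𝓝 1) := by
  have key : Tendsto (fun y : ℝ => ∫ x : ℝ, log (1 + ((y⁻¹ * x : ℝ) : ℂ) * I) ∂μ) atTop
      (𝓝 (∫ _, (0 : ℂ) ∂μ)) := by
    refine tendsto_integral_filter_of_dominated_convergence
      (fun x => (|Real.log (1 : ℂ).re| + Real.log (1 + ‖(1 : ℂ)‖) + Real.pi) + Real.log (1 + |x|))
      (Eventually.of_forall fun y => ?_) ?_ ((integrable_const _).add hμ) ?_
    · exact ((measurable_log_add_mul_I 1).comp (measurable_const_mul y⁻¹)).aestronglyMeasurable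
    · filter_upwards [eventually_ge_atTop 1] with y hy
      refine ae_of_all _ fun x => norm_log_add_mul_I_le (by simp) ?_
      rw [abs_mul, abs_inv, abs_of_pos (by linarith : 0 < y)]
      exact mul_le_of_le_one_left (abs_nonneg x) (inv_le_one_of_one_le₀ hy)
    · refine ae_of_all _ fun x => ?_
      have h2 : Tendsto (fun y : ℝ => 1 + ((y⁻¹ * x : ℝ) : ℂ) * I) atTop (𝓝 1) := by
        have : Tendsto (fun y : ℝ => y⁻¹ * x) atTop (𝓝 0) := by
          simpa using tendsto_inv_atTop_zero.mul_const x
        have := (((continuous_ofReal.tendsto 0).comp this).mul_const I).const_add 1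
        simpa using this
      have h3 := h2.clog (by simp)
      simpa using h3
  have key2 := (continuous_exp.tendsto _).comp key
  simp only [integral_zero, exp_zero] at key2
  refine key2.congr' ?_
  filter_upwards [eventually_gt_atTop 0] with y hy
  have hy' : (y : ℂ) ≠ 0 := by exact_mod_cast hy.ne'
  -- A positive real factor splits off the principal logarithm without a branch correction.
  have h5 : ∀ x : ℝ, log (1 + ((y⁻¹ * x : ℝ) : ℂ) * I) = log (y + x * I) - Real.log y := by
    intro x
    have h4 : (y : ℂ) + x * I = y * (1 + ((y⁻¹ * x : ℝ) : ℂ) * I) := by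
      push_cast; field_simp
    rw [h4, log_ofReal_mul hy (add_mul_I_ne_zero (by simp) _)]
    ring
  have h6 : ∫ x : ℝ, log (1 + ((y⁻¹ * x : ℝ) : ℂ) * I) ∂μ = logPotential μ y - Real.log y := by
    simp_rw [h5]
    rw [integral_sub (integrable_log_add_mul_I hμ (by simpa using hy)) (integrable_const _)]
    simp [logPotential]
  simp only [Function.comp_apply]
  rw [h6, Complex.exp_sub, ofReal_log hy.le, Complex.exp_log hy']

/-! ### From the differential equation to the exponential formula. -/

/-- The open right half-plane. -/
def rightHalfPlane : Set ℂ := {w | 0 < w.re}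

lemma isOpen_rightHalfPlane : IsOpen rightHalfPlane := isOpen_lt continuous_const continuous_re

lemma convex_rightHalfPlane : Convex ℝ rightHalfPlane := convex_halfSpace_re_gt 0

lemma eq_of_hasDerivAt_zero {f : ℂ → ℂ} (hf : ∀ w : ℂ, 0 < w.re → HasDerivAt f 0 w) {w z : ℂ}
    (hw : 0 < w.re) (hz : 0 < z.re) : f w = f z := by
  refine isOpen_rightHalfPlane.is_const_of_deriv_eq_zero convex_rightHalfPlane.isPreconnected
    (fun x hx => (hf x hx).differentiableAt.differentiableWithinAt) (fun x hx => (hf x hx).deriv)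
    hw hz

/-- If the Stieltjes transform `T` of `μ` satisfies
`T' = -T Λ'`, with `Λ` the logarithmic potential of `ν`, then `T = exp (-Λ)`. -/
lemma stieltjesRight_eq_exp_neg_logPotential {μ ν : Measure ℝ} [IsProbabilityMeasure μ]
    [IsProbabilityMeasure ν] (hν : Integrable (fun x : ℝ => Real.log (1 + |x|)) ν)
    (h : ∀ w : ℂ, 0 < w.re →
      ∫ x : ℝ, (w + x * I)⁻¹ ^ 2 ∂μ = stieltjesRight μ w * stieltjesRight ν w)
    {w : ℂ} (hw : 0 < w.re) : stieltjesRight μ w = exp (-logPotential ν w) := by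
  set f : ℂ → ℂ := fun z => stieltjesRight μ z * exp (logPotential ν z) with hf
  have hd : ∀ z : ℂ, 0 < z.re → HasDerivAt f 0 z := by
    intro z hz
    refine ((hasDerivAt_stieltjesRight hz).mul (hasDerivAt_logPotential hν hz).cexp).congr_deriv ?_
    rw [h z hz]
    ring
  have hlim : Tendsto (fun y : ℝ => f y) atTop (𝓝 1) := by
    have := (tendsto_mul_stieltjesRight μ).mul (tendsto_exp_logPotential_div hν)
    rw [one_mul] at this
    refine this.congr' ?_
    filter_upwards [eventually_gt_atTop 0] with y hy
    have hy' : (y : ℂ) ≠ 0 := by exact_mod_cast hy.ne'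
    simp only [hf]
    field_simp
  have h1 : f w = 1 := by
    refine tendsto_nhds_unique (tendsto_const_nhds.congr' ?_) hlim
    filter_upwards [eventually_gt_atTop 0] with y hy
    exact eq_of_hasDerivAt_zero hd hw (by simpa using hy)
  rw [Complex.exp_neg]
  exact eq_inv_of_mul_eq_one_left h1

end DirichletMean

/-! ### Stieltjes inversion. -/

namespace DirichletMean

open Complex Filter Topology BoundedContinuousFunction

lemma re_inv_poisson (ε : ℝ≥0) (x y : ℝ) :
    ((ε - y * I + x * I : ℂ)⁻¹).re = Real.pi * cauchyPDFReal x ε y := by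
  have h : (ε - y * I + x * I : ℂ) = ⟨ε, x - y⟩ := by
    apply Complex.ext <;> simp; ring
  rw [h, cauchyPDFReal_def, inv_re, normSq_mk, ← mul_assoc, ← mul_assoc,
    mul_inv_cancel₀ Real.pi_ne_zero, one_mul, div_eq_mul_inv]
  congr 2
  ring

/-- The substitution `y = x + ε s` moves `ε` into the argument of `f`, so that the limit `ε → 0` is
dominated by one fixed density. -/
lemma integral_mul_cauchyPDFReal (f : ℝ → ℝ) (x : ℝ) {ε : ℝ≥0} (hε : ε ≠ 0) :
    ∫ y, f y * cauchyPDFReal x ε y = ∫ s, f (x + ε * s) * cauchyPDFReal 0 1 s := by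
  have hε' : (ε : ℝ) ≠ 0 := by exact_mod_cast hε
  have h1 := Measure.integral_comp_mul_left
    (fun y => f (x + y) * cauchyPDFReal x ε (x + y)) (ε : ℝ)
  rw [integral_add_left_eq_self (fun y => f y * cauchyPDFReal x ε y) x] at h1
  have h2 : ∀ s : ℝ, f (x + ε * s) * cauchyPDFReal x ε (x + ε * s) =
      (ε : ℝ)⁻¹ * (f (x + ε * s) * cauchyPDFReal 0 1 s) := by
    intro s
    rw [cauchyPDFReal_def', cauchyPDFReal_def']
    simp [mul_div_cancel_left₀ _ hε']
    ring
  simp_rw [h2] at h1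
  rw [integral_const_mul, abs_of_nonneg (by positivity), smul_eq_mul] at h1
  exact (mul_left_cancel₀ (inv_ne_zero hε') h1).symm

lemma tendsto_integral_cauchy_average (μ : Measure ℝ) [IsFiniteMeasure μ] (f : ℝ →ᵇ ℝ) :
    Tendsto (fun ε : ℝ≥0 => ∫ x, (∫ s, f (x + ε * s) * cauchyPDFReal 0 1 s) ∂μ) (𝓝 0)
      (𝓝 (∫ x, f x ∂μ)) := by
  have hpdf : ∀ s : ℝ, 0 ≤ cauchyPDFReal 0 1 s := fun s => (cauchyPDF_pos 0 one_ne_zero s).le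
  have hb : ∀ (x s : ℝ) (ε : ℝ≥0),
      ‖f (x + ε * s) * cauchyPDFReal 0 1 s‖ ≤ ‖f‖ * cauchyPDFReal 0 1 s := by
    intro x s ε
    rw [norm_mul, Real.norm_of_nonneg (hpdf s)]
    exact mul_le_mul_of_nonneg_right (f.norm_coe_le_norm _) (hpdf s)
  refine tendsto_integral_filter_of_dominated_convergence (fun _ => ‖f‖)
    (Eventually.of_forall fun ε => ?_) (Eventually.of_forall fun ε => ae_of_all _ fun x => ?_)
    (integrable_const (μ := μ) ‖f‖) (ae_of_all _ fun x => ?_)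
  · refine (StronglyMeasurable.integral_prod_right (ν := volume)
      (f := fun x s : ℝ => f (x + ε * s) * cauchyPDFReal 0 1 s) ?_).aestronglyMeasurable
    refine Measurable.stronglyMeasurable ?_
    exact (f.continuous.measurable.comp (by fun_prop)).mul (by fun_prop)
  · refine (norm_integral_le_of_norm_le ((integrable_cauchyPDFReal 0).const_mul ‖f‖)
      (ae_of_all _ fun s => hb x s ε)).trans_eq ?_
    rw [integral_const_mul, integral_cauchyPDFReal_eq_one 0 one_ne_zero, mul_one]
  · have h : ∫ s, f x * cauchyPDFReal 0 1 s = f x := by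
      rw [integral_const_mul, integral_cauchyPDFReal_eq_one 0 one_ne_zero, mul_one]
    rw [← h]
    refine tendsto_integral_filter_of_dominated_convergence _ (Eventually.of_forall fun ε => ?_)
      (Eventually.of_forall fun ε => ae_of_all _ fun s => hb x s ε)
      ((integrable_cauchyPDFReal 0).const_mul ‖f‖) (ae_of_all _ fun s => ?_)
    · exact ((f.continuous.comp (by fun_prop)).measurable.mul (by fun_prop)).aestronglyMeasurable
    · have h3 : Continuous fun ε : ℝ≥0 => f (x + ε * s) * cauchyPDFReal 0 1 s := by fun_prop
      simpa using h3.tendsto 0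

lemma measurable_cauchyPDFReal_uncurry (ε : ℝ≥0) :
    Measurable fun p : ℝ × ℝ => cauchyPDFReal p.1 ε p.2 := by
  unfold cauchyPDFReal
  fun_prop

lemma integrable_cauchyPDFReal_prod (μ : Measure ℝ) [IsFiniteMeasure μ] {ε : ℝ≥0} (hε : ε ≠ 0) :
    Integrable (fun p : ℝ × ℝ => cauchyPDFReal p.1 ε p.2) (μ.prod volume) := by
  rw [integrable_prod_iff (measurable_cauchyPDFReal_uncurry ε).aestronglyMeasurable]
  refine ⟨ae_of_all _ fun x => integrable_cauchyPDFReal x, ?_⟩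
  have : ∀ x : ℝ, ∫ y, ‖cauchyPDFReal x ε y‖ = 1 := by
    intro x
    simp_rw [fun y => Real.norm_of_nonneg (cauchyPDF_pos x hε y).le]
    exact integral_cauchyPDFReal_eq_one x hε
  simp_rw [this]
  exact integrable_const _

/-- By Fubini the smoothing passes from `f` to `μ`, where the Cauchy density is the Poisson kernel,
the real part of the Stieltjes kernel. The smoothed integral thus depends on `μ` only through its
transform. -/
lemma integral_cauchy_average_eq (μ : Measure ℝ) [IsFiniteMeasure μ] (f : ℝ →ᵇ ℝ) {ε : ℝ≥0}
    (hε : ε ≠ 0) :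
    ∫ x, (∫ s, f (x + ε * s) * cauchyPDFReal 0 1 s) ∂μ =
      ∫ y, f y * (Real.pi⁻¹ * (stieltjesRight μ (ε - y * I)).re) := by
  rw [integral_congr_ae (ae_of_all _ fun x => (integral_mul_cauchyPDFReal f x hε).symm),
    integral_integral_swap]
  · refine integral_congr_ae (ae_of_all _ fun y => ?_)
    dsimp only
    have hre : 0 < (ε - y * I : ℂ).re := by simpa using pos_iff_ne_zero.2 hε
    rw [integral_const_mul, stieltjesRight, ← RCLike.re_eq_complex_re,
      ← integral_re (integrable_inv_add_mul_I hre)]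
    simp_rw [RCLike.re_eq_complex_re, re_inv_poisson, integral_const_mul]
    rw [inv_mul_cancel_left₀ Real.pi_ne_zero]
  · exact (integrable_cauchyPDFReal_prod μ hε).bdd_mul (c := ‖f‖)
      (f.continuous.measurable.comp measurable_snd).aestronglyMeasurable
      (ae_of_all _ fun p => f.norm_coe_le_norm _)

/-- **Stieltjes inversion**: the Stieltjes transform determines a finite measure. -/
theorem ext_of_stieltjesRight {μ ν : Measure ℝ} [IsFiniteMeasure μ] [IsFiniteMeasure ν]
    (h : ∀ w : ℂ, 0 < w.re → stieltjesRight μ w = stieltjesRight ν w) : μ = ν := by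
  refine ext_of_forall_integral_eq_of_IsFiniteMeasure fun f => ?_
  have hne : (𝓝[>] (0 : ℝ≥0)).NeBot := inferInstance
  have h1 := (tendsto_integral_cauchy_average μ f).mono_left (nhdsWithin_le_nhds (s := Set.Ioi 0))
  have h2 := (tendsto_integral_cauchy_average ν f).mono_left (nhdsWithin_le_nhds (s := Set.Ioi 0))
  refine tendsto_nhds_unique (h1.congr' ?_) h2
  filter_upwards [self_mem_nhdsWithin] with ε hε
  have hε' : ε ≠ 0 := (Set.mem_Ioi.1 hε).ne'
  rw [integral_cauchy_average_eq μ f hε', integral_cauchy_average_eq ν f hε']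
  congr with y
  rw [h]
  simpa using pos_iff_ne_zero.2 hε'

/-! ### Cauchy laws: transform and logarithmic moment. -/

lemma tendsto_inv_add_mul_I_cocompact (v : ℂ) :
    Tendsto (fun x : ℝ => (v + x * I)⁻¹) (cocompact ℝ) (𝓝 0) := by
  have h : Tendsto (fun x : ℝ => v + x * I) (cocompact ℝ) (Bornology.cobounded ℂ) := by
    rw [← tendsto_norm_atTop_iff_cobounded]
    refine tendsto_atTop_mono (f := fun x : ℝ => ‖x‖ - ‖v‖) (fun x => ?_)
      (tendsto_atTop_add_const_right _ _ _root_.tendsto_norm_cocompact_atTop)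
    have := norm_sub_le (v + x * I) v
    simp at this
    rw [Real.norm_eq_abs]
    linarith
  exact tendsto_inv₀_cobounded.comp h

lemma norm_sq_inv_add_mul_I {w : ℂ} (hw : 0 < w.re) (x : ℝ) :
    ‖(w + x * I)⁻¹‖ ^ 2 = Real.pi * w.re⁻¹ * cauchyPDFReal (-w.im) w.re.toNNReal x := by
  rw [norm_inv, inv_pow, Complex.sq_norm, normSq_apply, cauchyPDFReal_def, Real.coe_toNNReal _ hw.le]
  have : w.re ≠ 0 := hw.ne'
  have := Real.pi_ne_zero
  simp
  field_simp
  ring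

lemma integrable_inv_mul_inv {w v : ℂ} (hw : 0 < w.re) (hv : 0 < v.re) :
    Integrable fun x : ℝ => (w + x * I)⁻¹ * (v + x * I)⁻¹ := by
  have h : ∀ {w : ℂ}, 0 < w.re → Integrable fun x : ℝ => ‖(w + x * I)⁻¹‖ ^ 2 := by
    intro w hw
    simp_rw [norm_sq_inv_add_mul_I hw]
    exact (integrable_cauchyPDFReal _).const_mul _
  refine ((h hw).add (h hv)).mono' (by fun_prop) (ae_of_all _ fun x => ?_)
  rw [norm_mul, Pi.add_apply]
  nlinarith [sq_nonneg (‖(w + x * I)⁻¹‖ - ‖(v + x * I)⁻¹‖),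
    mul_nonneg (norm_nonneg (w + x * I)⁻¹) (norm_nonneg (v + x * I)⁻¹)]

lemma hasDerivAt_log_add_mul_I {w : ℂ} (hw : 0 < w.re) (x : ℝ) :
    HasDerivAt (fun x : ℝ => log (w + x * I)) (I * (w + x * I)⁻¹) x := by
  have h := ((hasDerivAt_id x).ofReal_comp.mul_const I).const_add w
  have := h.clog_real (add_mul_I_mem_slitPlane hw x)
  refine this.congr_deriv ?_
  simp [div_eq_mul_inv]

/-- Both arguments lie in `(-π/2, π/2)`, so their difference stays in the principal strip. -/
lemma log_sub_log_of_re_pos {a b : ℂ} (ha : 0 < a.re) (hb : 0 < b.re) :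
    log a - log b = log (a / b) := by
  have ha' := abs_lt.1 (abs_arg_lt_pi_div_two_iff.2 (Or.inl ha))
  have hb' := abs_lt.1 (abs_arg_lt_pi_div_two_iff.2 (Or.inl hb))
  have ha0 : a ≠ 0 := by rintro rfl; simp at ha
  have hb0 : b ≠ 0 := by rintro rfl; simp at hb
  rw [← log_exp (x := log a - log b), Complex.exp_sub, exp_log ha0, exp_log hb0]
  · simp only [sub_im, log_im]; linarith [ha'.1, hb'.2]
  · simp only [sub_im, log_im]; linarith [ha'.2, hb'.1]

/-- Both poles `iw` and `iv` lie in the upper half-plane, so a contour closed below would give zero.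
An explicit primitive with limit `0` at both ends replaces the contour. -/
lemma integral_inv_mul_inv_eq_zero {w v : ℂ} (hw : 0 < w.re) (hv : 0 < v.re) :
    ∫ x : ℝ, (w + x * I)⁻¹ * (v + x * I)⁻¹ = 0 := by
  obtain rfl | hne := eq_or_ne w v
  · have hd : ∀ x : ℝ, HasDerivAt (fun x : ℝ => I * (w + x * I)⁻¹)
        ((w + x * I)⁻¹ * (w + x * I)⁻¹) x := by
      intro x
      have h0 := add_mul_I_ne_zero hw x
      have h := ((((hasDerivAt_id x).ofReal_comp.mul_const I).const_add w).inv h0).const_mul I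
      refine h.congr_deriv ?_
      simp only [ofReal_one, id]
      generalize w + x * I = a at *
      field_simp
      simp
    have hl : Tendsto (fun x : ℝ => I * (w + x * I)⁻¹) (cocompact ℝ) (𝓝 0) := by
      simpa using (tendsto_inv_add_mul_I_cocompact w).const_mul I
    rw [integral_of_hasDerivAt_of_tendsto hd (integrable_inv_mul_inv hw hv)
      (hl.mono_left atBot_le_cocompact) (hl.mono_left atTop_le_cocompact), sub_zero]
  · have hne' : v - w ≠ 0 := sub_ne_zero.2 hne.symm
    have hd : ∀ x : ℝ, HasDerivAt
        (fun x : ℝ => (I * (v - w))⁻¹ * (log (w + x * I) - log (v + x * I)))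
        ((w + x * I)⁻¹ * (v + x * I)⁻¹) x := by
      intro x
      refine (((hasDerivAt_log_add_mul_I hw x).sub
        (hasDerivAt_log_add_mul_I hv x)).const_mul _).congr_deriv ?_
      have h1 := add_mul_I_ne_zero hw x
      have h2 := add_mul_I_ne_zero hv x
      have h3 : v - w = (v + x * I) - (w + x * I) := by ring
      rw [h3] at hne' ⊢
      generalize w + x * I = a at *
      generalize v + x * I = b at *
      have := I_ne_zero
      field_simp
    have hl : Tendsto (fun x : ℝ => (I * (v - w))⁻¹ * (log (w + x * I) - log (v + x * I)))
        (cocompact ℝ) (𝓝 0) := by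
      have h1 := (((tendsto_inv_add_mul_I_cocompact v).const_mul (w - v)).const_add 1).clog
        (by simp)
      have h2 := h1.const_mul (I * (v - w))⁻¹
      simp only [mul_zero, add_zero, log_one] at h2
      refine h2.congr fun x => ?_
      rw [log_sub_log_of_re_pos (by simpa using hw) (by simpa using hv)]
      have h2 := add_mul_I_ne_zero hv x
      have h3 : w - v = (w + x * I) - (v + x * I) := by ring
      rw [h3, sub_mul, mul_inv_cancel₀ h2, div_eq_mul_inv]
      ring_nf
    rw [integral_of_hasDerivAt_of_tendsto hd (integrable_inv_mul_inv hw hv)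
      (hl.mono_left atBot_le_cocompact) (hl.mono_left atTop_le_cocompact), sub_zero]

lemma integral_cauchyMeasure (θ : ℝ) {γ : ℝ≥0} (hγ : γ ≠ 0) (g : ℝ → ℂ) :
    ∫ x, g x ∂cauchyMeasure θ γ = ∫ x, (cauchyPDFReal θ γ x : ℂ) * g x := by
  rw [cauchyMeasure_of_scale_ne_zero θ hγ, integral_withDensity_eq_integral_toReal_smul
    (measurable_cauchyPDF θ γ) (ae_of_all _ fun x => ENNReal.ofReal_lt_top)]
  refine integral_congr_ae (ae_of_all _ fun x => ?_)
  simp [cauchyPDF, ENNReal.toReal_ofReal (cauchyPDF_pos θ hγ x).le]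

lemma stieltjesRight_dirac (θ : ℝ) (w : ℂ) :
    stieltjesRight (Measure.dirac θ) w = (w + θ * I)⁻¹ := by
  simp [stieltjesRight]

lemma stieltjesRight_cauchyMeasure (θ : ℝ) (γ : ℝ≥0) {w : ℂ} (hw : 0 < w.re) :
    stieltjesRight (cauchyMeasure θ γ) w = (w + γ + θ * I)⁻¹ := by
  obtain rfl | hγ := eq_or_ne γ 0
  · simp [stieltjesRight_dirac]
  have hγ' : (0 : ℝ) < γ := by exact_mod_cast pos_iff_ne_zero.2 hγ
  have hs : w + γ + θ * I ≠ 0 := add_mul_I_ne_zero (by simp; positivity) θ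
  rw [stieltjesRight, integral_cauchyMeasure θ hγ]
  -- Partial fractions: the density is `γ / (π b c)` with `b = γ - iθ + ix` and `c = γ + iθ - ix`.
  -- With `a = w + ix`, the sum `a + c` is free of `x`, whence `1 / (abc) = (a + c)⁻¹ (1 / (bc) + 1
  -- / (ab))`. The first term gives back the density, the second integrates to zero.
  have key : ∀ x : ℝ, (cauchyPDFReal θ γ x : ℂ) * (w + x * I)⁻¹ =
      (w + γ + θ * I)⁻¹ * cauchyPDFReal θ γ x + (w + γ + θ * I)⁻¹ * (Real.pi : ℂ)⁻¹ * γ *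
        ((w + x * I)⁻¹ * ((γ - θ * I) + x * I)⁻¹) := by
    intro x
    have h1 := add_mul_I_ne_zero hw x
    have h2 : (γ - θ * I : ℂ) + x * I ≠ 0 := add_mul_I_ne_zero (by simpa using hγ') x
    have h3 : (γ + θ * I : ℂ) - x * I ≠ 0 := by
      intro h
      have := congrArg re h
      simp at this
      exact hγ this
    have h4 : (cauchyPDFReal θ γ x : ℂ) = (Real.pi : ℂ)⁻¹ * γ *
        (((γ - θ * I) + x * I) * ((γ + θ * I) - x * I))⁻¹ := by
      rw [cauchyPDFReal_def]
      push_cast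
      congr 2
      ring_nf
      rw [I_sq]
      ring
    have hpi : (Real.pi : ℂ) ≠ 0 := by exact_mod_cast Real.pi_ne_zero
    have h5 : w + γ + θ * I = (w + x * I) + ((γ + θ * I) - x * I) := by ring
    rw [h4]
    rw [h5] at hs ⊢
    generalize w + x * I = a at *
    generalize (γ - θ * I : ℂ) + x * I = b at *
    generalize (γ + θ * I : ℂ) - x * I = c at *
    field_simp
  simp_rw [key]
  rw [integral_add, integral_const_mul, integral_const_mul, integral_complex_ofReal,
    integral_inv_mul_inv_eq_zero hw (by simpa using hγ'), integral_cauchyPDFReal_eq_one θ hγ]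
  · simp
  · exact (integrable_cauchyPDFReal θ).ofReal.const_mul _
  · exact (integrable_inv_mul_inv hw (by simpa using hγ')).const_mul _

lemma one_add_abs_sq_le (θ x : ℝ) {γ : ℝ} (hγ : 0 < γ) :
    (1 + |x|) ^ 2 ≤ (2 * (1 + |θ|) ^ 2 / γ ^ 2 + 2) * ((x - θ) ^ 2 + γ ^ 2) := by
  have h1 : |x| ≤ |x - θ| + |θ| := by simpa using abs_add_le (x - θ) θ
  have h2 : (1 + |x|) ^ 2 ≤ 2 * (1 + |θ|) ^ 2 + 2 * |x - θ| ^ 2 := by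
    have : (1 + |x|) ^ 2 ≤ ((1 + |θ|) + |x - θ|) ^ 2 :=
      pow_le_pow_left₀ (by positivity) (by linarith) 2
    nlinarith [sq_nonneg ((1 + |θ|) - |x - θ|)]
  rw [sq_abs] at h2
  have h3 : 2 * (1 + |θ|) ^ 2 / γ ^ 2 * γ ^ 2 = 2 * (1 + |θ|) ^ 2 := by field_simp
  have h4 : 0 ≤ 2 * (1 + |θ|) ^ 2 / γ ^ 2 * (x - θ) ^ 2 := by positivity
  nlinarith [sq_nonneg γ]

lemma integrable_log_cauchyMeasure (θ : ℝ) (γ : ℝ≥0) :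
    Integrable (fun x : ℝ => Real.log (1 + |x|)) (cauchyMeasure θ γ) := by
  obtain rfl | hγ := eq_or_ne γ 0
  · simpa using integrable_dirac (by simp)
  have hγ' : (0 : ℝ) < γ := by exact_mod_cast pos_iff_ne_zero.2 hγ
  rw [cauchyMeasure_of_scale_ne_zero θ hγ, integrable_withDensity_iff (measurable_cauchyPDF θ γ)
    (ae_of_all _ fun x => ENNReal.ofReal_lt_top)]
  set C := 2 * (1 + |θ|) ^ 2 / (γ : ℝ) ^ 2 + 2
  have hi : Integrable fun x : ℝ => 2 * Real.pi⁻¹ * γ * C * (1 + ‖x‖) ^ (-(3 / 2) : ℝ) :=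
    (integrable_one_add_norm (by simp; norm_num)).const_mul _
  refine hi.mono' ?_ (ae_of_all _ fun x => ?_)
  · exact (Measurable.mul (by fun_prop)
      (measurable_cauchyPDF θ γ).ennreal_toReal).aestronglyMeasurable
  have h1 : 0 < 1 + |x| := by positivity
  have h0 : 0 ≤ Real.log (1 + |x|) := Real.log_nonneg (by linarith [abs_nonneg x])
  rw [cauchyPDF, ENNReal.toReal_ofReal (cauchyPDF_pos θ hγ x).le,
    Real.norm_of_nonneg (mul_nonneg h0 (cauchyPDF_pos θ hγ x).le), Real.norm_eq_abs]
  -- A square root against the decay `(1 + |x|) ^ (-2)` of the density leaves the integrable power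
  -- `-3/2`.
  have h2 : Real.log (1 + |x|) ≤ 2 * (1 + |x|) ^ (1 / 2 : ℝ) := by
    have := Real.log_le_rpow_div h1.le (ε := 1 / 2) (by norm_num)
    linarith
  have h3 : ((x - θ) ^ 2 + (γ : ℝ) ^ 2)⁻¹ ≤ C * (1 + |x|) ^ (-2 : ℝ) := by
    rw [Real.rpow_neg h1.le, Real.rpow_two, ← div_eq_mul_inv, inv_le_comm₀ (by positivity)
      (by positivity), inv_div, div_le_iff₀ (by positivity), mul_comm]
    exact one_add_abs_sq_le θ x hγ'
  have h4 : (1 + |x|) ^ (-(3 / 2) : ℝ) = (1 + |x|) ^ (1 / 2 : ℝ) * (1 + |x|) ^ (-2 : ℝ) := by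
    rw [← Real.rpow_add h1]
    norm_num
  rw [cauchyPDFReal_def, h4]
  calc _ ≤ (2 * (1 + |x|) ^ (1 / 2 : ℝ)) * (Real.pi⁻¹ * γ * (C * (1 + |x|) ^ (-2 : ℝ))) := by
        gcongr
    _ = _ := by ring

end DirichletMean

/-! ### Gamma integrals with a complex rate. -/

namespace DirichletMean

open Complex Filter Topology

/-- The kernel `t ↦ t ^ (a - 1) e ^ (-w t)` of the Gamma integral, supported on `(0, ∞)`. -/
noncomputable def gammaKernel (a : ℝ) (w : ℂ) : ℝ → ℂ :=
  (Set.Ioi 0).indicator fun t => ((t ^ (a - 1) : ℝ) : ℂ) * exp (-(w * t))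

lemma gammaKernel_of_pos {a : ℝ} {w : ℂ} {t : ℝ} (ht : 0 < t) :
    gammaKernel a w t = ((t ^ (a - 1) : ℝ) : ℂ) * exp (-(w * t)) :=
  Set.indicator_of_mem ht _

lemma gammaKernel_of_nonpos {a : ℝ} {w : ℂ} {t : ℝ} (ht : t ≤ 0) : gammaKernel a w t = 0 :=
  Set.indicator_of_notMem (by simpa using ht) _

lemma measurable_gammaKernel (a : ℝ) (w : ℂ) : Measurable (gammaKernel a w) := by
  refine Measurable.indicator ?_ measurableSet_Ioi
  fun_prop

lemma norm_gammaKernel_le {a : ℝ} {w : ℂ} {r : ℝ} (hr : r ≤ w.re) (t : ℝ) :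
    ‖gammaKernel a w t‖ ≤
      (Set.Ioi 0).indicator (fun t : ℝ => t ^ (a - 1) * Real.exp (-(r * t))) t := by
  obtain ht | ht := lt_or_ge 0 t
  · rw [gammaKernel_of_pos ht, Set.indicator_of_mem (Set.mem_Ioi.2 ht), norm_mul, norm_real,
      Real.norm_of_nonneg (by positivity), norm_exp]
    simp only [neg_re, re_mul_ofReal]
    gcongr
  · rw [gammaKernel_of_nonpos ht, norm_zero]
    exact Set.indicator_nonneg (fun t ht => by have := Set.mem_Ioi.1 ht; positivity) _

lemma integrable_rpow_mul_exp_indicator {a r : ℝ} (ha : 0 < a) (hr : 0 < r) :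
    Integrable ((Set.Ioi 0).indicator fun t : ℝ => t ^ (a - 1) * Real.exp (-(r * t))) := by
  rw [integrable_indicator_iff measurableSet_Ioi]
  have := integrableOn_rpow_mul_exp_neg_mul_rpow (s := a - 1) (p := 1) (by linarith) one_pos hr
  simpa using this

lemma integrable_gammaKernel {a : ℝ} {w : ℂ} (ha : 0 < a) (hw : 0 < w.re) :
    Integrable (gammaKernel a w) :=
  (integrable_rpow_mul_exp_indicator ha hw).mono' (measurable_gammaKernel a w).aestronglyMeasurable
    (ae_of_all _ (norm_gammaKernel_le le_rfl))

lemma hasDerivAt_integral_gammaKernel {a : ℝ} {w : ℂ} (ha : 0 < a) (hw : 0 < w.re) :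
    HasDerivAt (fun w => ∫ t, gammaKernel a w t) (∫ t, -gammaKernel (a + 1) w t) w := by
  refine (hasDerivAt_integral_of_dominated_loc_of_deriv_le
    (F := fun z t => gammaKernel a z t) (F' := fun z t => -gammaKernel (a + 1) z t)
    (Metric.ball_mem_nhds w (half_pos hw))
    (Eventually.of_forall fun z => (measurable_gammaKernel a z).aestronglyMeasurable)
    (integrable_gammaKernel ha hw) (measurable_gammaKernel (a + 1) w).neg.aestronglyMeasurable
    (ae_of_all _ fun t z hz => ?_)
    (integrable_rpow_mul_exp_indicator (a := a + 1) (by linarith) (half_pos hw))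
    (ae_of_all _ fun t z hz => ?_)).2
  · rw [norm_neg]
    exact norm_gammaKernel_le (re_pos_of_mem_ball hz) t
  · obtain ht | ht := lt_or_ge 0 t
    · simp_rw [gammaKernel_of_pos ht]
      have h1 := (((hasDerivAt_id z).mul_const (t : ℂ)).neg.cexp).const_mul
        ((t ^ (a - 1) : ℝ) : ℂ)
      refine h1.congr_deriv ?_
      have h2 : t ^ (a + 1 - 1) = t ^ (a - 1) * t := by
        rw [show a + 1 - 1 = (a - 1) + 1 by ring, Real.rpow_add_one ht.ne']
      rw [h2]
      simp
      ring
    · simp_rw [gammaKernel_of_nonpos ht]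
      simpa using hasDerivAt_const z (0 : ℂ)

lemma integral_gammaKernel_ofReal {a r : ℝ} (ha : 0 < a) (hr : 0 < r) :
    ∫ t, gammaKernel a r t = (r : ℂ) ^ (-a : ℂ) * Real.Gamma a := by
  rw [gammaKernel, integral_indicator measurableSet_Ioi]
  have h := integral_cpow_mul_exp_neg_mul_Ioi (a := a) (by simpa using ha) hr
  rw [one_div, inv_cpow _ _ (by rw [arg_ofReal_of_nonneg hr.le]; exact Real.pi_ne_zero.symm),
    ← cpow_neg, Gamma_ofReal] at h
  rw [← h]
  refine setIntegral_congr_fun measurableSet_Ioi fun t ht => ?_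
  have ht' : (0 : ℝ) ≤ t := (Set.mem_Ioi.1 ht).le
  simp [ofReal_cpow ht']

/-- The Gamma integral with a complex rate of positive real part. -/
theorem integral_gammaKernel {a : ℝ} {w : ℂ} (ha : 0 < a) (hw : 0 < w.re) :
    ∫ t, gammaKernel a w t = w ^ (-a : ℂ) * Real.Gamma a := by
  have h1 : AnalyticOnNhd ℂ (fun w => ∫ t, gammaKernel a w t) rightHalfPlane :=
    DifferentiableOn.analyticOnNhd (fun z hz =>
      (hasDerivAt_integral_gammaKernel ha hz).differentiableAt.differentiableWithinAt)
      isOpen_rightHalfPlane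
  have h2 : AnalyticOnNhd ℂ (fun w : ℂ => w ^ (-a : ℂ) * Real.Gamma a) rightHalfPlane :=
    DifferentiableOn.analyticOnNhd (fun z hz =>
      ((differentiableAt_id.cpow_const (mem_slitPlane_of_re_pos hz)).mul_const
        _).differentiableWithinAt) isOpen_rightHalfPlane
  have h1mem : (1 : ℂ) ∈ rightHalfPlane := by simp [rightHalfPlane]
  refine h1.eqOn_of_preconnected_of_frequently_eq h2 convex_rightHalfPlane.isPreconnected h1mem
    ?_ hw
  -- Both sides are analytic and agree at positive reals; these accumulate at `1`, and the identity
  -- theorem applies.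
  have hlim : Tendsto (fun n : ℕ => ((1 + 1 / ((n : ℝ) + 1) : ℝ) : ℂ)) atTop (𝓝[≠] 1) := by
    refine tendsto_nhdsWithin_iff.2 ⟨?_, Eventually.of_forall fun n => ?_⟩
    · have := (continuous_ofReal.tendsto _).comp
        (tendsto_one_div_add_atTop_nhds_zero_nat.const_add (1 : ℝ))
      simpa [Function.comp_def] using this
    · have : (1 + 1 / ((n : ℝ) + 1) : ℝ) ≠ 1 := by
        have : 0 < 1 / ((n : ℝ) + 1) := by positivity
        linarith
      rw [Set.mem_compl_singleton_iff, ← ofReal_one, Ne, ofReal_inj]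
      exact this
  exact hlim.frequently (Frequently.of_forall fun n =>
    integral_gammaKernel_ofReal ha (by positivity))

/-! ### The Dirichlet distribution and its Markov–Krein identity. -/

/-- The `n + 1` barycentric coordinates of a point given by its first `n` coordinates. -/
def simplexCoord {n : ℕ} (u : Fin n → ℝ) : Fin (n + 1) → ℝ := Fin.snoc u (1 - ∑ i, u i)

@[simp]
lemma simplexCoord_castSucc {n : ℕ} (u : Fin n → ℝ) (i : Fin n) :
    simplexCoord u i.castSucc = u i := by simp [simplexCoord]

@[simp]
lemma simplexCoord_last {n : ℕ} (u : Fin n → ℝ) :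
    simplexCoord u (Fin.last n) = 1 - ∑ i, u i := by simp [simplexCoord]

lemma sum_simplexCoord {n : ℕ} (u : Fin n → ℝ) : ∑ i, simplexCoord u i = 1 := by
  simp [Fin.sum_univ_castSucc]

lemma sum_ofReal_simplexCoord {n : ℕ} (u : Fin n → ℝ) : ∑ i, (simplexCoord u i : ℂ) = 1 := by
  exact_mod_cast sum_simplexCoord u

lemma simplexCoord_pos_iff {n : ℕ} {u : Fin n → ℝ} :
    (∀ i, 0 < simplexCoord u i) ↔ u ∈ openSimplex n := by
  simp [Fin.forall_fin_succ', openSimplex]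

@[fun_prop]
lemma measurable_simplexCoord {n : ℕ} (i : Fin (n + 1)) :
    Measurable fun u : Fin n → ℝ => simplexCoord u i := by
  refine Fin.lastCases ?_ (fun i => ?_) i
  · simp only [simplexCoord_last]; fun_prop
  · simp only [simplexCoord_castSucc]; fun_prop

/-- The Dirichlet density without its normalizing constant. -/
noncomputable def dirichletKernel {n : ℕ} (b : Fin (n + 1) → ℝ) : (Fin n → ℝ) → ℝ :=
  (openSimplex n).indicator fun u => ∏ i, simplexCoord u i ^ (b i - 1)

lemma measurableSet_openSimplex (n : ℕ) : MeasurableSet (openSimplex n) := by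
  have : openSimplex n = ⋂ i, {u : Fin n → ℝ | 0 < simplexCoord u i} := by
    ext u
    simp [← simplexCoord_pos_iff]
  rw [this]
  exact MeasurableSet.iInter fun i => measurableSet_lt measurable_const (by fun_prop)

lemma measurable_dirichletKernel {n : ℕ} (b : Fin (n + 1) → ℝ) :
    Measurable (dirichletKernel b) :=
  Measurable.indicator (by fun_prop) (measurableSet_openSimplex n)

lemma dirichletKernel_nonneg {n : ℕ} (b : Fin (n + 1) → ℝ) (u : Fin n → ℝ) :
    0 ≤ dirichletKernel b u :=
  Set.indicator_nonneg (fun _ hu => Finset.prod_nonneg fun i _ =>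
    Real.rpow_nonneg (simplexCoord_pos_iff.2 hu i).le _) u

lemma dirichletPDFReal_eq {n : ℕ} (b : Fin (n + 1) → ℝ) (u : Fin n → ℝ) :
    dirichletPDFReal b u =
      Real.Gamma (∑ i, b i) / (∏ i, Real.Gamma (b i)) * dirichletKernel b u := by
  by_cases hu : u ∈ openSimplex n
  · simp [dirichletPDFReal, dirichletKernel, hu, Fin.prod_univ_castSucc (fun i =>
      simplexCoord u i ^ (b i - 1))]
  · simp [dirichletPDFReal, dirichletKernel, hu]

/-- The product of Gamma kernels, at a point whose coordinates sum to `s`. -/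
noncomputable def gammaProduct {n : ℕ} (b : Fin (n + 1) → ℝ) (c : Fin (n + 1) → ℂ) (s : ℝ)
    (v : Fin n → ℝ) : ℂ :=
  (∏ i : Fin n, gammaKernel (b i.castSucc) (c i.castSucc) (v i)) *
    gammaKernel (b (Fin.last n)) (c (Fin.last n)) (s - ∑ i, v i)

lemma gammaProduct_of_nonpos {n : ℕ} (b : Fin (n + 1) → ℝ) (c : Fin (n + 1) → ℂ) {s : ℝ}
    (hs : s ≤ 0) (v : Fin n → ℝ) : gammaProduct b c s v = 0 := by
  rw [gammaProduct]
  by_cases h : ∃ i, v i ≤ 0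
  · obtain ⟨i, hi⟩ := h
    rw [Finset.prod_eq_zero (Finset.mem_univ i) (gammaKernel_of_nonpos hi), zero_mul]
  · push Not at h
    have : 0 ≤ ∑ i, v i := Finset.sum_nonneg fun i _ => (h i).le
    rw [gammaKernel_of_nonpos (by linarith), mul_zero]

/-- Independent Gamma variables split into their sum `s` and their proportions `u`. The `n + 1`
factors `s ^ (b i - 1)` produce the exponent of `s`. -/
lemma gammaProduct_smul {n : ℕ} (b : Fin (n + 1) → ℝ) (c : Fin (n + 1) → ℂ) {s : ℝ}
    (hs : 0 < s) (u : Fin n → ℝ) :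
    gammaProduct b c s (s • u) = ((s ^ (∑ i, b i - (n + 1)) : ℝ) : ℂ) * dirichletKernel b u *
      exp (-((∑ i, c i * simplexCoord u i) * s)) := by
  have h1 : gammaProduct b c s (s • u) =
      ∏ i, gammaKernel (b i) (c i) (s * simplexCoord u i) := by
    rw [gammaProduct, Fin.prod_univ_castSucc]
    simp [mul_sub, Finset.mul_sum]
  rw [h1]
  by_cases hu : u ∈ openSimplex n
  · have hpos := simplexCoord_pos_iff.2 hu
    have h2 : ∀ i, gammaKernel (b i) (c i) (s * simplexCoord u i) =
        (((s ^ (b i - 1) * simplexCoord u i ^ (b i - 1) : ℝ)) : ℂ) *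
          exp (-(c i * simplexCoord u i * s)) := by
      intro i
      rw [gammaKernel_of_pos (mul_pos hs (hpos i)), Real.mul_rpow hs.le (hpos i).le]
      congr 2
      push_cast
      ring
    simp_rw [h2]
    rw [Finset.prod_mul_distrib, ← ofReal_prod, Finset.prod_mul_distrib, ← exp_sum,
      Finset.sum_neg_distrib, ← Finset.sum_mul, ← Real.rpow_sum_of_pos hs, dirichletKernel,
      Set.indicator_of_mem hu]
    simp
  · obtain ⟨i, hi⟩ : ∃ i, simplexCoord u i ≤ 0 := by
      by_contra! h
      exact hu (simplexCoord_pos_iff.1 h)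
    rw [dirichletKernel, Set.indicator_of_notMem hu, Finset.prod_eq_zero (Finset.mem_univ i)
      (gammaKernel_of_nonpos (mul_nonpos_of_nonneg_of_nonpos hs.le hi))]
    simp

variable {n : ℕ} {b : Fin (n + 1) → ℝ} {c : Fin (n + 1) → ℂ}

lemma integrable_prod_gammaKernel (hb : ∀ i, 0 < b i) (hc : ∀ i, 0 < (c i).re) :
    Integrable fun v : Fin n → ℝ =>
      ∏ i : Fin n, gammaKernel (b i.castSucc) (c i.castSucc) (v i) :=
  Integrable.fintype_prod (f := fun i : Fin n => gammaKernel (b i.castSucc) (c i.castSucc))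
    fun _ => integrable_gammaKernel (hb _) (hc _)

lemma integrable_gammaProduct (hb : ∀ i, 0 < b i) (hc : ∀ i, 0 < (c i).re) :
    Integrable (fun p : (Fin n → ℝ) × ℝ => gammaProduct b c p.2 p.1) (volume.prod volume) := by
  have h1 := (integrable_prod_gammaKernel hb hc).mul_prod
    (integrable_gammaKernel (hb (Fin.last n)) (hc (Fin.last n)))
  -- The shear from the total to the last coordinate preserves volume.
  have h2 : MeasurePreserving (fun p : (Fin n → ℝ) × ℝ => (p.1, p.2 - ∑ i, p.1 i))
      (volume.prod volume) (volume.prod volume) :=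
    (MeasurePreserving.id volume).skew_product (g := fun (v : Fin n → ℝ) (t : ℝ) => t - ∑ i, v i) (by fun_prop)
      (ae_of_all _ fun v => (measurePreserving_sub_right volume (∑ i, v i)).map_eq)
  exact h2.integrable_comp_of_integrable h1

lemma integral_gammaProduct (hb : ∀ i, 0 < b i) (hc : ∀ i, 0 < (c i).re) :
    ∫ s, ∫ v, gammaProduct b c s v = ∏ i, (c i ^ (-b i : ℂ) * Real.Gamma (b i)) := by
  rw [integral_integral_swap (integrable_gammaProduct hb hc).swap]
  have h1 : ∀ v : Fin n → ℝ, ∫ s, gammaProduct b c s v =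
      (∏ i : Fin n, gammaKernel (b i.castSucc) (c i.castSucc) (v i)) *
        ∫ t, gammaKernel (b (Fin.last n)) (c (Fin.last n)) t := by
    intro v
    simp only [gammaProduct]
    rw [integral_const_mul, integral_sub_right_eq_self
      (fun t => gammaKernel (b (Fin.last n)) (c (Fin.last n)) t)]
  simp_rw [h1]
  rw [integral_mul_const, integral_fintype_prod_volume_eq_prod
    (fun i : Fin n => gammaKernel (b i.castSucc) (c i.castSucc)), Fin.prod_univ_castSucc]
  simp_rw [integral_gammaKernel (hb _) (hc _)]

/-- By Fubini some slice `s > 0` of the Gamma product is integrable. With all rates equal to `1` the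
exponential is constant on it, so the rescaled slice is a multiple of the kernel. -/
lemma integrable_dirichletKernel (hb : ∀ i, 0 < b i) : Integrable (dirichletKernel b) := by
  have h1 := (integrable_gammaProduct (c := fun _ => 1) hb (by simp)).prod_left_ae
  obtain ⟨s, hs, hs0⟩ : ∃ s : ℝ, Integrable (fun v => gammaProduct b (fun _ => 1) s v) ∧ 0 < s := by
    have h2 : ∃ᵐ s : ℝ, s ∈ Set.Ioi (0 : ℝ) := by
      rw [frequently_ae_mem_iff]
      simp
    exact (h2.and_eventually h1).exists.imp fun s hs => ⟨hs.2, hs.1⟩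
  have h3 := (hs.comp_smul hs0.ne').const_mul
    (((s ^ (∑ i, b i - (n + 1)) : ℝ) : ℂ)⁻¹ * exp s)
  refine (h3.re).congr (ae_of_all _ fun u => ?_)
  have h4 : ((s ^ (∑ i, b i - (n + 1)) : ℝ) : ℂ) ≠ 0 := by
    exact_mod_cast (Real.rpow_pos_of_pos hs0 _).ne'
  simp only [gammaProduct_smul b _ hs0, one_mul, sum_ofReal_simplexCoord]
  have h6 : (((s ^ (∑ i, b i - (n + 1)) : ℝ) : ℂ)⁻¹ * exp s) *
      (((s ^ (∑ i, b i - (n + 1)) : ℝ) : ℂ) * dirichletKernel b u * exp (-s)) =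
        dirichletKernel b u := by
    rw [Complex.exp_neg]
    have := Complex.exp_ne_zero s
    field_simp
  rw [h6]
  simp

lemma integral_gammaProduct_of_pos {s : ℝ} (hs : 0 < s) :
    ∫ v, gammaProduct b c s v =
      ∫ u, dirichletKernel b u * gammaKernel (∑ i, b i) (∑ i, c i * simplexCoord u i) s := by
  have h := Measure.integral_comp_smul volume (gammaProduct b c s) s
  simp only [Module.finrank_fintype_fun_eq_card, Fintype.card_fin] at h
  rw [abs_of_pos (by positivity), eq_inv_smul_iff₀ (by positivity)] at h
  rw [← h, ← integral_smul]
  refine integral_congr_ae (ae_of_all _ fun u => ?_)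
  dsimp only
  -- The Jacobian `s ^ n` completes the exponent to that of a Gamma kernel with parameter `∑ b i`.
  have h2 : s ^ (∑ i, b i - 1) = s ^ n * s ^ (∑ i, b i - (n + 1)) := by
    rw [← Real.rpow_natCast, ← Real.rpow_add hs]
    ring_nf
  rw [gammaProduct_smul b c hs, gammaKernel_of_pos hs, h2, real_smul]
  push_cast
  ring

lemma re_sum_mul_simplexCoord_pos {r : ℝ} (hc : ∀ i, r ≤ (c i).re)
    {u : Fin n → ℝ} (hu : u ∈ openSimplex n) : r ≤ (∑ i, c i * simplexCoord u i).re := by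
  have hpos := simplexCoord_pos_iff.2 hu
  rw [re_sum]
  calc r = ∑ i, r * simplexCoord u i := by rw [← Finset.mul_sum, sum_simplexCoord, mul_one]
    _ ≤ _ := Finset.sum_le_sum fun i _ => by
      rw [re_mul_ofReal]
      exact mul_le_mul_of_nonneg_right (hc i) (hpos i).le

lemma exists_pos_le_re (hc : ∀ i, 0 < (c i).re) : ∃ r : ℝ, 0 < r ∧ ∀ i, r ≤ (c i).re := by
  obtain ⟨i, hi⟩ := Finite.exists_min fun i => (c i).re
  exact ⟨_, hc i, hi⟩

lemma measurable_gammaKernel_uncurry (a : ℝ) {α : Type*} [MeasurableSpace α] {f : α → ℂ}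
    {g : α → ℝ} (hf : Measurable f) (hg : Measurable g) :
    Measurable fun x => gammaKernel a (f x) (g x) := by
  have : (fun x => gammaKernel a (f x) (g x)) = (g ⁻¹' Set.Ioi 0).indicator
      fun x => ((g x ^ (a - 1) : ℝ) : ℂ) * exp (-(f x * g x)) := by
    ext x
    simp only [gammaKernel, Set.indicator, Set.mem_preimage]
  rw [this]
  exact Measurable.indicator (by fun_prop) (hg measurableSet_Ioi)

/-- The same integral in two coordinate systems: a product of Gamma integrals in Cartesian ones, and
a Gamma integral in `s` for each fixed `u` after rescaling. -/
lemma integral_dirichletKernel_mul_cpow (hb : ∀ i, 0 < b i) (hc : ∀ i, 0 < (c i).re) :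
    ∫ u, dirichletKernel b u * ((∑ i, c i * simplexCoord u i) ^ (-(∑ i, b i : ℝ) : ℂ) *
      Real.Gamma (∑ i, b i)) = ∏ i, (c i ^ (-b i : ℂ) * Real.Gamma (b i)) := by
  have hβ : 0 < ∑ i, b i := Finset.sum_pos (fun i _ => hb i) Finset.univ_nonempty
  obtain ⟨r, hr, hrc⟩ := exists_pos_le_re hc
  rw [← integral_gammaProduct hb hc]
  have h1 : ∀ s : ℝ, ∫ v, gammaProduct b c s v =
      ∫ u, dirichletKernel b u * gammaKernel (∑ i, b i) (∑ i, c i * simplexCoord u i) s := by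
    intro s
    obtain hs | hs := lt_or_ge 0 s
    · exact integral_gammaProduct_of_pos hs
    · simp_rw [gammaProduct_of_nonpos b c hs, gammaKernel_of_nonpos hs, mul_zero]
  simp_rw [h1]
  rw [integral_integral_swap]
  · refine integral_congr_ae (ae_of_all _ fun u => ?_)
    dsimp only
    rw [integral_const_mul]
    by_cases hu : u ∈ openSimplex n
    · rw [integral_gammaKernel hβ (hr.trans_le (re_sum_mul_simplexCoord_pos hrc hu))]
    · simp [dirichletKernel, hu]
  · refine ((integrable_rpow_mul_exp_indicator hβ hr).mul_prod
      (integrable_dirichletKernel hb)).mono' ?_ (ae_of_all _ fun p => ?_)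
    · refine Measurable.aestronglyMeasurable (Measurable.mul ?_ ?_)
      · exact measurable_ofReal.comp ((measurable_dirichletKernel b).comp measurable_snd)
      · exact measurable_gammaKernel_uncurry _ (by fun_prop) (by fun_prop)
    · simp only [Function.uncurry]
      rw [norm_mul, norm_real, Real.norm_of_nonneg (dirichletKernel_nonneg b _), mul_comm]
      by_cases hu : p.2 ∈ openSimplex n
      · exact mul_le_mul_of_nonneg_right
          (norm_gammaKernel_le (re_sum_mul_simplexCoord_pos hrc hu) _)
          (dirichletKernel_nonneg b _)
      · simp [dirichletKernel, hu]

lemma dirichletPDFReal_nonneg (hb : ∀ i, 0 < b i) (u : Fin n → ℝ) : 0 ≤ dirichletPDFReal b u := by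
  have hβ : 0 < ∑ i, b i := Finset.sum_pos (fun i _ => hb i) Finset.univ_nonempty
  rw [dirichletPDFReal_eq]
  exact mul_nonneg (div_nonneg (Real.Gamma_pos_of_pos hβ).le
    (Finset.prod_nonneg fun i _ => (Real.Gamma_pos_of_pos (hb i)).le)) (dirichletKernel_nonneg b u)

lemma measurable_dirichletPDFReal (b : Fin (n + 1) → ℝ) : Measurable (dirichletPDFReal b) := by
  have : dirichletPDFReal b = _ := funext (dirichletPDFReal_eq b)
  rw [this]
  exact (measurable_dirichletKernel b).const_mul _

lemma integral_dirichletMeasure (hb : ∀ i, 0 < b i) (f : (Fin n → ℝ) → ℂ) :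
    ∫ u, f u ∂dirichletMeasure b = ∫ u, dirichletPDFReal b u * f u := by
  rw [dirichletMeasure, integral_withDensity_eq_integral_toReal_smul
    (measurable_dirichletPDFReal b).ennreal_ofReal (ae_of_all _ fun x => ENNReal.ofReal_lt_top)]
  refine integral_congr_ae (ae_of_all _ fun x => ?_)
  simp [ENNReal.toReal_ofReal (dirichletPDFReal_nonneg hb x)]

/-- The **Markov–Krein identity** for the Dirichlet distribution. -/
theorem integral_dirichletMeasure_cpow (hb : ∀ i, 0 < b i) (hc : ∀ i, 0 < (c i).re) :
    ∫ u, (∑ i, c i * simplexCoord u i) ^ (-(∑ i, b i : ℝ) : ℂ) ∂dirichletMeasure b =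
      ∏ i, c i ^ (-b i : ℂ) := by
  have hβ : 0 < ∑ i, b i := Finset.sum_pos (fun i _ => hb i) Finset.univ_nonempty
  have h := integral_dirichletKernel_mul_cpow hb hc
  have hG : (∏ i, (Real.Gamma (b i) : ℂ)) ≠ 0 :=
    Finset.prod_ne_zero_iff.2 fun i _ => by exact_mod_cast (Real.Gamma_pos_of_pos (hb i)).ne'
  rw [Finset.prod_mul_distrib, ← div_eq_iff hG, ← integral_div] at h
  rw [integral_dirichletMeasure hb, ← h]
  refine integral_congr_ae (ae_of_all _ fun u => ?_)
  simp only [dirichletPDFReal_eq]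
  push_cast
  ring

lemma isProbabilityMeasure_dirichletMeasure (hb : ∀ i, 0 < b i) :
    IsProbabilityMeasure (dirichletMeasure b) := by
  have h := integral_dirichletMeasure_cpow (c := fun _ => 1) hb (by simp)
  simp_rw [one_mul, sum_ofReal_simplexCoord] at h
  rw [isProbabilityMeasure_iff_real]
  simpa using h

end DirichletMean

/-! ### Stick breaking and the perpetuity equation. -/

namespace DirichletMean

open Complex Filter Topology

/-- Prepend a term to a sequence. -/
def consSeq {E : Type*} (p : E × (ℕ → E)) : ℕ → E
  | 0 => p.1
  | k + 1 => p.2 k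

lemma measurable_consSeq {E : Type*} [MeasurableSpace E] : Measurable (consSeq (E := E)) := by
  refine measurable_pi_iff.2 fun k => ?_
  cases k with
  | zero => exact measurable_fst
  | succ k => exact (measurable_pi_apply k).comp measurable_snd

lemma map_consSeq {E : Type*} [MeasurableSpace E] (κ : Measure E) [IsProbabilityMeasure κ] :
    (κ.prod (Measure.infinitePi fun _ : ℕ => κ)).map consSeq =
      Measure.infinitePi fun _ : ℕ => κ := by
  refine Measure.eq_infinitePi _ fun s t ht => ?_
  rw [Measure.map_apply measurable_consSeq
    (MeasurableSet.pi s.countable_toSet fun i _ => ht i)]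
  set s' : Finset ℕ := s.preimage Nat.succ (Nat.succ_injective.injOn) with hs'
  have h1 : consSeq ⁻¹' (s : Set ℕ).pi t =
      (if 0 ∈ s then t 0 else Set.univ) ×ˢ (s' : Set ℕ).pi fun j => t (j + 1) := by
    ext ⟨x, ω⟩
    simp only [Set.mem_preimage, Set.mem_pi, Finset.mem_coe, Set.mem_prod, hs',
      Finset.mem_preimage]
    constructor
    · intro h
      refine ⟨?_, fun j hj => h (j + 1) hj⟩
      split_ifs with h0
      · exact h 0 h0
      · trivial
    · rintro ⟨h0, h⟩ i hi
      cases i with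
      | zero => simpa [hi, consSeq] using h0
      | succ j => exact h j hi
  rw [h1, Measure.prod_prod, Measure.infinitePi_pi _ fun i _ => ht (i + 1)]
  have h2 : ∏ j ∈ s', κ (t (j + 1)) = ∏ i ∈ s, if i = 0 then 1 else κ (t i) := by
    have := Finset.prod_preimage Nat.succ s (Nat.succ_injective.injOn)
      (fun i => if i = 0 then 1 else κ (t i)) (fun x _ hx => by
        cases x with
        | zero => simp
        | succ k => exact absurd ⟨k, rfl⟩ hx)
    simpa using this
  have h3 : κ (if 0 ∈ s then t 0 else Set.univ) = ∏ i ∈ s, if i = 0 then κ (t i) else 1 := by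
    rw [Finset.prod_ite_eq' s 0 fun i => κ (t i)]
    split_ifs <;> simp
  rw [h2, h3, ← Finset.prod_mul_distrib]
  refine Finset.prod_congr rfl fun i _ => ?_
  split_ifs <;> simp

/-- Under a product measure with equal factors, the first term of a sequence is independent of the
shifted sequence, which has the same law. -/
lemma measurePreserving_head_tail {E : Type*} [MeasurableSpace E] (κ : Measure E)
    [IsProbabilityMeasure κ] :
    MeasurePreserving (fun ω : ℕ → E => (ω 0, fun k => ω (k + 1)))
      (Measure.infinitePi fun _ : ℕ => κ) (κ.prod (Measure.infinitePi fun _ : ℕ => κ)) := by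
  have hm : Measurable (fun ω : ℕ → E => (ω 0, fun k => ω (k + 1))) := by fun_prop
  refine ⟨hm, ?_⟩
  nth_rewrite 1 [← map_consSeq κ]
  rw [Measure.map_map hm measurable_consSeq]
  exact Measure.map_id

/-- The weights of the stick-breaking construction. -/
noncomputable def stickWeight (ω : ℕ → ℝ × unitInterval) (k : ℕ) : ℝ :=
  (ω k).2 * ∏ j ∈ Finset.range k, (1 - (ω j).2 : ℝ)

lemma stickWeight_nonneg (ω : ℕ → ℝ × unitInterval) (k : ℕ) : 0 ≤ stickWeight ω k :=
  mul_nonneg (ω k).2.2.1 (Finset.prod_nonneg fun j _ => sub_nonneg.2 (ω j).2.2.2)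

lemma stickWeight_succ (ω : ℕ → ℝ × unitInterval) (k : ℕ) :
    stickWeight ω (k + 1) = (1 - (ω 0).2) * stickWeight (fun j => ω (j + 1)) k := by
  rw [stickWeight, stickWeight, Finset.prod_range_succ']
  ring

lemma sum_stickWeight (ω : ℕ → ℝ × unitInterval) (k : ℕ) :
    ∑ i ∈ Finset.range k, stickWeight ω i = 1 - ∏ j ∈ Finset.range k, (1 - (ω j).2 : ℝ) := by
  induction k with
  | zero => simp
  | succ k ih => rw [Finset.sum_range_succ, Finset.prod_range_succ, ih, stickWeight]; ring

@[fun_prop]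
lemma measurable_stickWeight (k : ℕ) : Measurable fun ω => stickWeight ω k := by
  unfold stickWeight
  fun_prop

/-- The random discrete measure of the stick-breaking construction. -/
noncomputable def stickMeasure (ω : ℕ → ℝ × unitInterval) : Measure ℝ :=
  Measure.sum fun k => ENNReal.ofReal (stickWeight ω k) • Measure.dirac (ω k).1

lemma stickMeasure_apply (ω : ℕ → ℝ × unitInterval) {C : Set ℝ} (hC : MeasurableSet C) :
    stickMeasure ω C = ∑' k, ENNReal.ofReal (stickWeight ω k) * C.indicator 1 (ω k).1 := by
  simp [stickMeasure, Measure.sum_apply _ hC, Measure.dirac_apply' _ hC]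

lemma measurable_stickMeasure : Measurable stickMeasure := by
  refine Measure.measurable_of_measurable_coe _ fun C hC => ?_
  simp_rw [stickMeasure_apply _ hC]
  refine Measurable.tsum fun k => Measurable.mul (by fun_prop) ?_
  exact (measurable_one.indicator hC).comp (by fun_prop)

lemma stickMeasure_univ_le (ω : ℕ → ℝ × unitInterval) : stickMeasure ω Set.univ ≤ 1 := by
  rw [stickMeasure_apply ω MeasurableSet.univ]
  refine ENNReal.tsum_le_of_sum_range_le fun k => ?_
  simp only [Set.indicator_univ, Pi.one_apply, mul_one]
  rw [← ENNReal.ofReal_sum_of_nonneg fun i _ => stickWeight_nonneg ω i, sum_stickWeight,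
    ENNReal.ofReal_le_one]
  have : 0 ≤ ∏ j ∈ Finset.range k, (1 - (ω j).2 : ℝ) :=
    Finset.prod_nonneg fun j _ => sub_nonneg.2 (ω j).2.2.2
  linarith

instance (ω : ℕ → ℝ × unitInterval) : IsFiniteMeasure (stickMeasure ω) :=
  ⟨(stickMeasure_univ_le ω).trans_lt ENNReal.one_lt_top⟩

lemma stickMeasure_real (ω : ℕ → ℝ × unitInterval) {C : Set ℝ} (hC : MeasurableSet C) :
    (stickMeasure ω).real C = (ω 0).2 * C.indicator 1 (ω 0).1 +
      (1 - (ω 0).2) * (stickMeasure fun k => ω (k + 1)).real C := by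
  have h : stickMeasure ω C = ENNReal.ofReal (ω 0).2 * C.indicator 1 (ω 0).1 +
      ENNReal.ofReal (1 - (ω 0).2) * stickMeasure (fun k => ω (k + 1)) C := by
    rw [stickMeasure_apply ω hC, stickMeasure_apply _ hC, tsum_eq_zero_add' ENNReal.summable,
      ← ENNReal.tsum_mul_left]
    congr 1
    · simp [stickWeight]
    · refine tsum_congr fun k => ?_
      rw [stickWeight_succ, ENNReal.ofReal_mul (sub_nonneg.2 (ω 0).2.2.2), mul_assoc]
  have hi : (C.indicator (1 : ℝ → ℝ≥0∞) (ω 0).1).toReal = C.indicator 1 (ω 0).1 := by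
    by_cases hx : (ω 0).1 ∈ C <;> simp [hx]
  have hf : C.indicator (1 : ℝ → ℝ≥0∞) (ω 0).1 ≠ ⊤ := by
    by_cases hx : (ω 0).1 ∈ C <;> simp [hx]
  rw [Measure.real, h, ENNReal.toReal_add (ENNReal.mul_ne_top ENNReal.ofReal_ne_top hf)
    (ENNReal.mul_ne_top ENNReal.ofReal_ne_top (measure_ne_top _ _)), ENNReal.toReal_mul,
    ENNReal.toReal_mul, hi, ENNReal.toReal_ofReal (ω 0).2.2.1,
    ENNReal.toReal_ofReal (sub_nonneg.2 (ω 0).2.2.2)]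
  rfl

lemma integral_unitInterval {F : Type*} [NormedAddCommGroup F] [NormedSpace ℝ F] (g : ℝ → F) :
    ∫ b : unitInterval, g b = ∫ b in (0 : ℝ)..1, g b := by
  rw [intervalIntegral.integral_of_le zero_le_one, ← integral_Icc_eq_integral_Ioc]
  exact integral_subtype_comap measurableSet_Icc g

/-- The law of the sequence of atoms and relative stick lengths. -/
noncomputable def stickLaw (α : Measure ℝ) : Measure (ℕ → ℝ × unitInterval) :=
  Measure.infinitePi fun _ : ℕ => α.prod (volume : Measure unitInterval)

variable (α : Measure ℝ) [IsProbabilityMeasure α]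

instance : IsProbabilityMeasure (stickLaw α) := by unfold stickLaw; infer_instance

/-- Integration of a bounded function of the first atom, the first stick length and the shifted
sequence. -/
lemma integral_stickLaw {F : Type*} [NormedAddCommGroup F] [NormedSpace ℝ F]
    [SecondCountableTopology F] [MeasurableSpace F] [BorelSpace F]
    (g : ℝ → unitInterval → (ℕ → ℝ × unitInterval) → F)
    (hg : Measurable fun p : (ℝ × unitInterval) × (ℕ → ℝ × unitInterval) => g p.1.1 p.1.2 p.2)
    {K : ℝ} (hK : ∀ x b ω, ‖g x b ω‖ ≤ K) :
    ∫ ω, g (ω 0).1 (ω 0).2 (fun k => ω (k + 1)) ∂stickLaw α =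
      ∫ ω, ∫ x, ∫ b, g x b ω ∂volume ∂α ∂stickLaw α := by
  have hmp := measurePreserving_head_tail (α.prod (volume : Measure unitInterval))
  have h1 := integral_map (μ := stickLaw α) hmp.measurable.aemeasurable
    (f := fun p : (ℝ × unitInterval) × (ℕ → ℝ × unitInterval) => g p.1.1 p.1.2 p.2)
    hg.aestronglyMeasurable
  rw [stickLaw] at h1 ⊢
  rw [← h1, hmp.map_eq, integral_prod_symm]
  · refine integral_congr_ae (ae_of_all _ fun ω => ?_)
    refine integral_prod (fun p : ℝ × unitInterval => g p.1 p.2 ω) ?_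
    exact Integrable.of_bound (hg.comp (measurable_id.prodMk measurable_const)).aestronglyMeasurable K
      (ae_of_all _ fun p => hK _ _ _)
  · exact Integrable.of_bound hg.aestronglyMeasurable K (ae_of_all _ fun p => hK _ _ _)

lemma measurable_stickMeasure_real {C : Set ℝ} (hC : MeasurableSet C) :
    Measurable fun ω => (stickMeasure ω).real C :=
  ((Measure.measurable_coe hC).comp measurable_stickMeasure).ennreal_toReal

lemma stickMeasure_real_le (ω : ℕ → ℝ × unitInterval) (C : Set ℝ) :
    (stickMeasure ω).real C ≤ 1 :=
  ENNReal.toReal_le_of_le_ofReal zero_le_one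
    (by simpa using (measure_mono (Set.subset_univ C)).trans (stickMeasure_univ_le ω))

/-- The missing mass `d` is `1 - B` times an independent copy of itself. As `1 - B` has mean `1/2`,
so `E d = E d / 2 = 0`. -/
lemma ae_isProbabilityMeasure_stickMeasure :
    ∀ᵐ ω ∂stickLaw α, IsProbabilityMeasure (stickMeasure ω) := by
  set d : (ℕ → ℝ × unitInterval) → ℝ := fun ω => 1 - (stickMeasure ω).real Set.univ with hd
  have hd0 : ∀ ω, 0 ≤ d ω := fun ω => sub_nonneg.2 (stickMeasure_real_le ω _)
  have hd1 : ∀ ω, d ω ≤ 1 := fun ω => sub_le_self _ measureReal_nonneg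
  have hdm : Measurable d := (measurable_stickMeasure_real MeasurableSet.univ).const_sub 1
  have hrec : ∀ ω, d ω = (1 - (ω 0).2 : ℝ) * d fun k => ω (k + 1) := by
    intro ω
    simp only [hd]
    rw [stickMeasure_real ω MeasurableSet.univ]
    simp
    ring
  have hint : Integrable d (stickLaw α) :=
    Integrable.of_bound hdm.aestronglyMeasurable 1 (ae_of_all _ fun ω => by
      rw [Real.norm_of_nonneg (hd0 ω)]; exact hd1 ω)
  have h1 : ∫ ω, d ω ∂stickLaw α = 1 / 2 * ∫ ω, d ω ∂stickLaw α := by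
    have h2 := integral_stickLaw α (fun _ b ω => (1 - b : ℝ) * d ω)
      ((by fun_prop : Measurable fun p : (ℝ × unitInterval) × (ℕ → ℝ × unitInterval) =>
        (1 - p.1.2 : ℝ)).mul (hdm.comp measurable_snd)) (K := 1) (fun _ b ω => by
        rw [Real.norm_of_nonneg (mul_nonneg (sub_nonneg.2 b.2.2) (hd0 ω))]
        exact mul_le_one₀ (sub_le_self _ b.2.1) (hd0 ω) (hd1 ω))
    have h3 : ∫ b : unitInterval, (1 - b : ℝ) = 1 / 2 := by
      rw [integral_unitInterval fun b => 1 - b]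
      rw [intervalIntegral.integral_sub (by simp) (by simp), integral_id]
      norm_num
    simp_rw [← hrec, integral_mul_const, h3] at h2
    simpa [integral_const_mul] using h2
  have h0 : ∫ ω, d ω ∂stickLaw α = 0 := by linarith
  rw [integral_eq_zero_iff_of_nonneg hd0 hint] at h0
  filter_upwards [h0] with ω hω
  rw [isProbabilityMeasure_iff_real]
  simp [hd] at hω
  linarith

lemma integral_inv_sq_segment {p q : ℂ} (hp : 0 < p.re) (hq : 0 < q.re) :
    ∫ b in (0 : ℝ)..1, ((b * q + (1 - b) * p : ℂ))⁻¹ ^ 2 = p⁻¹ * q⁻¹ := by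
  have hp0 : p ≠ 0 := by rintro rfl; simp at hp
  have hq0 : q ≠ 0 := by rintro rfl; simp at hq
  have hne : ∀ b ∈ Set.uIcc (0 : ℝ) 1, (b * q + (1 - b) * p : ℂ) ≠ 0 := by
    intro b hb h
    rw [Set.uIcc_of_le zero_le_one] at hb
    have h1 := congrArg re h
    have h2 : ((1 : ℂ) - b).re = 1 - b := by simp
    have h3 : ((1 : ℂ) - b).im = 0 := by simp
    rw [add_re, re_ofReal_mul, mul_re, h2, h3, zero_mul, sub_zero, zero_re] at h1
    obtain hb0 | hb0 := hb.1.eq_or_lt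
    · rw [← hb0] at h1; simp at h1; exact hp.ne' h1
    · nlinarith [mul_pos hb0 hq, mul_nonneg (sub_nonneg.2 hb.2) hp.le]
  -- The primitive `b / (p (b q + (1 - b) p))` vanishes at `0` and equals `1 / (p q)` at `1`, with
  -- no division by `q - p`.
  have hd : ∀ b ∈ Set.uIcc (0 : ℝ) 1, HasDerivAt
      (fun b : ℝ => p⁻¹ * ((b : ℂ) * (b * q + (1 - b) * p : ℂ)⁻¹))
      (((b * q + (1 - b) * p : ℂ))⁻¹ ^ 2) b := by
    intro b hb
    have h0 := hne b hb
    have hid : HasDerivAt (fun b : ℝ => (b : ℂ)) 1 b := by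
      simpa using (hasDerivAt_id b).ofReal_comp
    have h1 : HasDerivAt (fun b : ℝ => (b * q + (1 - b) * p : ℂ)) (1 * q + (-1) * p) b :=
      (hid.mul_const q).add ((hid.const_sub 1).mul_const p)
    refine ((hid.mul (h1.fun_inv h0)).const_mul p⁻¹).congr_deriv ?_
    field_simp
    ring
  rw [intervalIntegral.integral_eq_sub_of_hasDerivAt hd]
  · simp
  · refine ContinuousOn.intervalIntegrable fun b hb => ContinuousAt.continuousWithinAt ?_
    have h1 : ContinuousAt (fun b : ℝ => (b * q + (1 - b) * p : ℂ)) b := by fun_prop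
    exact (h1.inv₀ (hne b hb)).pow 2

/-- The Stieltjes transform of the solution of the perpetuity equation `Z = B Y + (1 - B) Z'`, with
`B` uniform. -/
theorem stieltjesRight_map_of_perpetuity {Z : (ℕ → ℝ × unitInterval) → ℝ} (hZ : Measurable Z)
    {f : ℝ → ℝ} (hf : Measurable f)
    (hlog : Integrable (fun x : ℝ => Real.log (1 + |x|)) (α.map f))
    (h : ∀ ω, Z ω = (ω 0).2 * f (ω 0).1 + (1 - (ω 0).2) * Z fun k => ω (k + 1))
    {w : ℂ} (hw : 0 < w.re) :
    stieltjesRight ((stickLaw α).map Z) w = exp (-logPotential (α.map f) w) := by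
  have := Measure.isProbabilityMeasure_map (μ := stickLaw α) hZ.aemeasurable
  have := Measure.isProbabilityMeasure_map (μ := α) hf.aemeasurable
  refine stieltjesRight_eq_exp_neg_logPotential hlog (fun w hw => ?_) hw
  rw [stieltjesRight, stieltjesRight, integral_map hZ.aemeasurable (by fun_prop),
    integral_map hZ.aemeasurable (by fun_prop), integral_map hf.aemeasurable (by fun_prop)]
  have h1 := integral_stickLaw α
    (fun x b ω => (w + (b * f x + (1 - b) * Z ω : ℝ) * I)⁻¹ ^ 2) (K := w.re⁻¹ ^ 2)
    (by
      have h2 : Measurable fun p : (ℝ × unitInterval) × (ℕ → ℝ × unitInterval) =>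
          (p.1.2 * f p.1.1 + (1 - p.1.2) * Z p.2 : ℝ) := by fun_prop
      exact ((measurable_const.add
        ((measurable_ofReal.comp h2).mul_const I)).inv).pow_const 2)
    (fun x b ω => by
      rw [norm_pow]
      gcongr
      exact norm_inv_add_mul_I_le hw _)
  simp_rw [← h] at h1
  rw [h1, ← integral_mul_const]
  refine integral_congr_ae (ae_of_all _ fun ω => ?_)
  dsimp only
  rw [← integral_const_mul]
  refine integral_congr_ae (ae_of_all _ fun x => ?_)
  dsimp only
  have h3 : ∀ b : ℝ, (w + ((b * f x + (1 - b) * Z ω : ℝ) : ℂ) * I) =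
      b * (w + f x * I) + (1 - b) * (w + Z ω * I) := by
    intro b
    push_cast
    ring
  rw [integral_unitInterval fun b => (w + ((b * f x + (1 - b) * Z ω : ℝ) : ℂ) * I)⁻¹ ^ 2]
  simp_rw [h3]
  exact integral_inv_sq_segment (by simpa using hw) (by simpa using hw)

end DirichletMean

/-! ### Existence of the Dirichlet process. -/

namespace DirichletMean

open Complex Filter Topology

lemma integral_dirichletMeasure_inv {n : ℕ} {b : Fin (n + 1) → ℝ} {c : Fin (n + 1) → ℂ}
    (hb : ∀ i, 0 < b i) (hb1 : ∑ i, b i = 1) (hc : ∀ i, 0 < (c i).re) :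
    ∫ u, (∑ i, c i * simplexCoord u i)⁻¹ ∂dirichletMeasure b = exp (-∑ i, b i * log (c i)) := by
  have h := integral_dirichletMeasure_cpow hb hc
  rw [hb1] at h
  simp_rw [ofReal_one, cpow_neg_one] at h
  rw [h, ← Finset.sum_neg_distrib, exp_sum]
  refine Finset.prod_congr rfl fun i _ => ?_
  have h0 : c i ≠ 0 := by
    intro h0
    have := hc i
    simp [h0] at this
  rw [cpow_def_of_ne_zero h0]
  congr 1
  ring

lemma sum_indicator_partition {ι M : Type*} [Fintype ι] [AddCommMonoid M] {C : ι → Set ℝ}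
    (hd : Pairwise fun i j => Disjoint (C i) (C j)) (hu : ⋃ i, C i = Set.univ) {h : ℝ → M}
    {c : ι → M} (hc : ∀ i, ∀ x ∈ C i, h x = c i) (x : ℝ) :
    h x = ∑ i, (C i).indicator (fun _ => c i) x := by
  obtain ⟨i, hi⟩ := Set.mem_iUnion.1 (hu ▸ Set.mem_univ x)
  rw [Finset.sum_eq_single i, Set.indicator_of_mem hi, hc i x hi]
  · intro j _ hj
    exact Set.indicator_of_notMem (fun hxj => (hd hj).le_bot ⟨hxj, hi⟩) _
  · simp

lemma integral_of_partition {ι : Type*} [Fintype ι] {C : ι → Set ℝ}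
    (hm : ∀ i, MeasurableSet (C i)) (hd : Pairwise fun i j => Disjoint (C i) (C j))
    (hu : ⋃ i, C i = Set.univ) (ν : Measure ℝ) [IsFiniteMeasure ν] {h : ℝ → ℂ} {c : ι → ℂ}
    (hc : ∀ i, ∀ x ∈ C i, h x = c i) : ∫ x, h x ∂ν = ∑ i, ν.real (C i) * c i := by
  simp_rw [sum_indicator_partition hd hu hc]
  rw [integral_finsetSum _ fun i _ => (integrable_const (c i)).indicator (hm i)]
  refine Finset.sum_congr rfl fun i _ => ?_
  rw [integral_indicator_const _ (hm i)]
  simp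

lemma sum_real_partition {ι : Type*} [Fintype ι] {C : ι → Set ℝ}
    (hm : ∀ i, MeasurableSet (C i)) (hd : Pairwise fun i j => Disjoint (C i) (C j))
    (hu : ⋃ i, C i = Set.univ) (ν : Measure ℝ) [IsProbabilityMeasure ν] :
    ∑ i, ν.real (C i) = 1 := by
  have h := integral_of_partition hm hd hu ν (h := fun _ => 1) (c := fun _ => 1) fun _ _ _ => rfl
  simp only [integral_const, probReal_univ, one_smul, mul_one] at h
  exact_mod_cast h.symm

lemma simplexCoord_real_partition {n : ℕ} {C : Fin (n + 1) → Set ℝ}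
    (hm : ∀ i, MeasurableSet (C i)) (hd : Pairwise fun i j => Disjoint (C i) (C j))
    (hu : ⋃ i, C i = Set.univ) (ν : Measure ℝ) [IsProbabilityMeasure ν] (i : Fin (n + 1)) :
    simplexCoord (fun j : Fin n => ν.real (C j.castSucc)) i = ν.real (C i) := by
  refine Fin.lastCases ?_ (fun i => ?_) i
  · rw [simplexCoord_last, ← sum_real_partition hm hd hu ν, Fin.sum_univ_castSucc]
    ring
  · rw [simplexCoord_castSucc]

lemma measurable_probabilityMeasure_real {C : Set ℝ} (hC : MeasurableSet C) :
    Measurable fun φ : ProbabilityMeasure ℝ => (φ : Measure ℝ).real C :=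
  ((Measure.measurable_coe hC).comp measurable_subtype_coe).ennreal_toReal

open Classical in
/-- The random probability measure of the stick-breaking construction. -/
noncomputable def stickProbability (ω : ℕ → ℝ × unitInterval) : ProbabilityMeasure ℝ :=
  ⟨if IsProbabilityMeasure (stickMeasure ω) then stickMeasure ω else Measure.dirac 0, by
    split_ifs with h
    · exact h
    · infer_instance⟩

lemma coe_stickProbability {ω : ℕ → ℝ × unitInterval} (h : IsProbabilityMeasure (stickMeasure ω)) :
    (stickProbability ω : Measure ℝ) = stickMeasure ω := if_pos h

lemma measurable_stickProbability : Measurable stickProbability := by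
  classical
  refine Measurable.subtype_mk ?_
  exact Measurable.ite (measurable_stickMeasure
    ProbabilityMeasure.measurableSet_isProbabilityMeasure) measurable_stickMeasure measurable_const

/-- A measure on `Fin n → ℝ` is determined by its images under linear forms. -/
lemma ext_of_map_linear {n : ℕ} {μ ν : Measure (Fin n → ℝ)} [IsFiniteMeasure μ]
    [IsFiniteMeasure ν]
    (h : ∀ l : Fin n → ℝ, μ.map (fun u => ∑ i, l i * u i) = ν.map fun u => ∑ i, l i * u i) :
    μ = ν := by
  refine Measure.ext_of_charFunDual (funext fun L => ?_)
  have hL : (L : (Fin n → ℝ) → ℝ) = fun u => ∑ i, L (Pi.single i 1) * u i := by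
    ext u
    conv_lhs => rw [← Finset.univ_sum_single u]
    rw [map_sum]
    refine Finset.sum_congr rfl fun i _ => ?_
    rw [mul_comm, ← smul_eq_mul, ← map_smul, ← Pi.single_smul, smul_eq_mul, mul_one]
  rw [charFunDual_eq_charFun_map_one, charFunDual_eq_charFun_map_one, hL, h]

lemma integrable_log_map_of_bounded (α : Measure ℝ) [IsFiniteMeasure α] {f : ℝ → ℝ}
    (hf : Measurable f) {K : ℝ} (hK : ∀ x, |f x| ≤ K) :
    Integrable (fun x : ℝ => Real.log (1 + |x|)) (α.map f) := by
  have hm : Measurable fun x : ℝ => Real.log (1 + |x|) := Real.measurable_log.comp (by fun_prop)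
  rw [integrable_map_measure hm.aestronglyMeasurable hf.aemeasurable]
  refine Integrable.of_bound (hm.comp hf).aestronglyMeasurable (Real.log (1 + K)) (ae_of_all _ fun x => ?_)
  have h0 := abs_nonneg (f x)
  rw [Function.comp_apply, Real.norm_of_nonneg (Real.log_nonneg (by linarith))]
  exact Real.log_le_log (by linarith) (by linarith [hK x])

variable {α : Measure ℝ} [IsProbabilityMeasure α]

/-- The Stieltjes transform of `∑ l_i φ(C_i)`, for `φ` the stick-breaking random measure. -/
lemma stieltjesRight_map_stickMeasure {ι : Type*} [Fintype ι] {C : ι → Set ℝ}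
    (hm : ∀ i, MeasurableSet (C i)) (hd : Pairwise fun i j => Disjoint (C i) (C j))
    (hu : ⋃ i, C i = Set.univ) (l : ι → ℝ) {w : ℂ} (hw : 0 < w.re) :
    stieltjesRight ((stickLaw α).map fun ω => ∑ i, l i * (stickMeasure ω).real (C i)) w =
      exp (-∑ i, α.real (C i) * log (w + l i * I)) := by
  -- The linear form in the masses of the cells is the integral of this step function, and it solves
  -- the perpetuity equation with `Y = f (X)`, `X` of law `α`.
  set f : ℝ → ℝ := fun x => ∑ i, l i * (C i).indicator 1 x with hf
  have hfm : Measurable f := by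
    refine Finset.measurable_fun_sum _ fun i _ => Measurable.const_mul ?_ _
    exact measurable_one.indicator (hm i)
  have hfb : ∀ x, |f x| ≤ ∑ i, |l i| := by
    intro x
    refine (Finset.abs_sum_le_sum_abs _ _).trans (Finset.sum_le_sum fun i _ => ?_)
    rw [abs_mul]
    refine mul_le_of_le_one_right (abs_nonneg _) ?_
    by_cases hx : x ∈ C i <;> simp [hx]
  have hfc : ∀ i, ∀ x ∈ C i, f x = l i := by
    intro i x hx
    have h := sum_indicator_partition hd hu (h := f) (c := l) ?_ x
    · rw [h, Finset.sum_eq_single i]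
      · simp [hx]
      · intro j _ hj
        exact Set.indicator_of_notMem (fun hxj => (hd hj).le_bot ⟨hxj, hx⟩) _
      · simp
    · intro i x hx
      simp only [hf]
      rw [Finset.sum_eq_single i]
      · simp [hx]
      · intro j _ hj
        rw [Set.indicator_of_notMem (fun hxj => (hd hj).le_bot ⟨hxj, hx⟩), mul_zero]
      · simp
  rw [stieltjesRight_map_of_perpetuity α
    (Finset.measurable_fun_sum _ fun i _ => (measurable_stickMeasure_real (hm i)).const_mul _) hfm
    (integrable_log_map_of_bounded α hfm hfb) ?_ hw]
  · rw [logPotential, integral_map hfm.aemeasurable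
      (measurable_log_add_mul_I w).aestronglyMeasurable,
      integral_of_partition hm hd hu α (c := fun i => log (w + l i * I)) fun i x hx => by
        rw [hfc i x hx]]
  · intro ω
    simp only [hf]
    rw [Finset.mul_sum, Finset.mul_sum, ← Finset.sum_add_distrib]
    refine Finset.sum_congr rfl fun i _ => ?_
    rw [stickMeasure_real ω (hm i)]
    ring

/-- Every linear form has the same Stieltjes transform under both laws: the perpetuity computes one
side, the Gamma integral the other. -/
lemma map_partition_stickProbability {n : ℕ} {C : Fin (n + 1) → Set ℝ}
    (hm : ∀ i, MeasurableSet (C i)) (hd : Pairwise fun i j => Disjoint (C i) (C j))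
    (hu : ⋃ i, C i = Set.univ) (h0 : ∀ i, α (C i) ≠ 0) :
    ((stickLaw α).map stickProbability).map (fun φ : ProbabilityMeasure ℝ =>
      fun i : Fin n => (φ : Measure ℝ).real (C i.castSucc)) =
        dirichletMeasure fun i => α.real (C i) := by
  have hb : ∀ i, 0 < α.real (C i) := fun i =>
    ENNReal.toReal_pos (h0 i) (measure_ne_top _ _)
  have hVm : Measurable fun φ : ProbabilityMeasure ℝ =>
      fun i : Fin n => (φ : Measure ℝ).real (C i.castSucc) :=
    measurable_pi_iff.2 fun i => measurable_probabilityMeasure_real (hm _)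
  have := isProbabilityMeasure_dirichletMeasure hb
  rw [Measure.map_map hVm measurable_stickProbability]
  have hVs := hVm.comp measurable_stickProbability
  have := Measure.isProbabilityMeasure_map (μ := stickLaw α) hVs.aemeasurable
  refine ext_of_map_linear fun l => ?_
  have hl : Measurable fun u : Fin n → ℝ => ∑ i, l i * u i := by fun_prop
  refine ext_of_stieltjesRight fun w hw => ?_
  -- The last cell is not a coordinate of the vector, so it receives coefficient `0`.
  set l' : Fin (n + 1) → ℝ := Fin.snoc l 0 with hl'
  have hsum : ∀ v : Fin (n + 1) → ℝ, ∑ i, l' i * v i = ∑ i : Fin n, l i * v i.castSucc := by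
    intro v
    simp [Fin.sum_univ_castSucc, hl']
  rw [Measure.map_map hl hVs, Measure.map_congr (g := fun ω =>
    ∑ i, l' i * (stickMeasure ω).real (C i)) ?_, stieltjesRight_map_stickMeasure hm hd hu l' hw]
  · rw [stieltjesRight, integral_map hl.aemeasurable (by fun_prop),
      ← integral_dirichletMeasure_inv hb (sum_real_partition hm hd hu α) (c := fun i => w + l' i * I)
        (by simpa using hw)]
    refine integral_congr_ae (ae_of_all _ fun u => ?_)
    dsimp only
    have h1 := hsum (simplexCoord u)
    simp only [simplexCoord_castSucc] at h1
    simp_rw [add_mul, Finset.sum_add_distrib]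
    rw [← Finset.mul_sum, sum_ofReal_simplexCoord, mul_one, ← h1]
    push_cast
    rw [Finset.sum_mul]
    congr 2
    exact Finset.sum_congr rfl fun i _ => by ring
  · filter_upwards [ae_isProbabilityMeasure_stickMeasure α] with ω hω
    simp only [Function.comp_apply]
    rw [coe_stickProbability hω, hsum fun i => (stickMeasure ω).real (C i)]

lemma ae_null_stickProbability {N : Set ℝ} (hN : MeasurableSet N) (h0 : α N = 0) :
    ∀ᵐ φ : ProbabilityMeasure ℝ ∂(stickLaw α).map stickProbability, (φ : Measure ℝ) N = 0 := by
  have hms : MeasurableSet {φ : ProbabilityMeasure ℝ | (φ : Measure ℝ) N = 0} :=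
    (Measure.measurable_coe hN).comp measurable_subtype_coe (measurableSet_singleton 0)
  rw [ae_map_iff measurable_stickProbability.aemeasurable hms]
  -- The atoms have law `α`, so almost surely all of them avoid `N`.
  have hX : ∀ᵐ ω ∂stickLaw α, ∀ k, (ω k).1 ∉ N := by
    refine ae_all_iff.2 fun k => ?_
    have h1 : ∀ᵐ p ∂α.prod (volume : Measure unitInterval), p.1 ∉ N := by
      have := (Measure.quasiMeasurePreserving_fst (μ := α)
        (ν := (volume : Measure unitInterval))).ae (measure_eq_zero_iff_ae_notMem.1 h0)
      exact this
    exact (measurePreserving_eval_infinitePi (fun _ : ℕ => α.prod (volume : Measure unitInterval))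
      k).quasiMeasurePreserving.ae h1
  filter_upwards [hX, ae_isProbabilityMeasure_stickMeasure α] with ω hω hp
  rw [coe_stickProbability hp, stickMeasure_apply ω hN]
  simp [hω]

/-- **Existence of the Dirichlet process** with a parameter of total mass one. -/
theorem isDirichletProcess_stick :
    IsDirichletProcess α ((stickLaw α).map stickProbability) where
  isProbabilityMeasure := Measure.isProbabilityMeasure_map measurable_stickProbability.aemeasurable
  map_partition _ _ hm hd hu h0 := map_partition_stickProbability hm hd hu h0
  ae_null _ hN h0 := ae_null_stickProbability hN h0

lemma isDirichletProcess_dirichletProcess (α : Measure ℝ) [IsProbabilityMeasure α] :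
    IsDirichletProcess α (dirichletProcess α) := by
  have h : ∃ D, IsDirichletProcess α D := ⟨_, isDirichletProcess_stick⟩
  rw [dirichletProcess, dif_pos h]
  exact h.choose_spec

end DirichletMean

/-! ### The Markov–Krein identity for an arbitrary Dirichlet process. -/

namespace DirichletMean

open Complex Filter Topology

lemma tendsto_integral_log_one_add_mul {α : Measure ℝ} {f : ℝ → ℝ} (hf : Measurable f) (hf0 : ∀ x, 0 ≤ f x)
    (hlog : Integrable (fun x => Real.log (1 + f x)) α) :
    Tendsto (fun k : ℕ => ∫ x, Real.log (1 + 1 / ((k : ℝ) + 1) * f x) ∂α) atTop (𝓝 0) := by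
  rw [show (0 : ℝ) = ∫ _, (0 : ℝ) ∂α by simp]
  refine tendsto_integral_of_dominated_convergence _ (fun k => ?_) hlog
    (fun k => ae_of_all _ fun x => ?_) (ae_of_all _ fun x => ?_)
  · exact (Real.measurable_log.comp (by fun_prop)).aestronglyMeasurable
  · have h1 : 1 / ((k : ℝ) + 1) ≤ 1 := by
      rw [div_le_one (by positivity)]
      have : (0 : ℝ) ≤ k := k.cast_nonneg
      linarith
    have h2 : 0 ≤ 1 / ((k : ℝ) + 1) * f x := mul_nonneg (by positivity) (hf0 x)
    rw [Real.norm_of_nonneg (Real.log_nonneg (by linarith))]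
    exact Real.log_le_log (by linarith) (by nlinarith [hf0 x])
  · have h1 := (tendsto_one_div_add_atTop_nhds_zero_nat (𝕜 := ℝ)).mul_const (f x)
    rw [zero_mul] at h1
    have h2 := (h1.const_add 1).log (by simp)
    simpa using h2

section Transform

variable {α : Measure ℝ} [IsProbabilityMeasure α] {D : Measure (ProbabilityMeasure ℝ)}

lemma IsDirichletProcess.integral_inv_partition (hD : IsDirichletProcess α D) {n : ℕ}
    {C : Fin (n + 1) → Set ℝ} (hm : ∀ i, MeasurableSet (C i))
    (hd : Pairwise fun i j => Disjoint (C i) (C j)) (hu : ⋃ i, C i = Set.univ)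
    (h0 : ∀ i, α (C i) ≠ 0) {g : ℝ → ℂ} {c : Fin (n + 1) → ℂ} (hg : ∀ i, ∀ x ∈ C i, g x = c i)
    (hc : ∀ i, 0 < (c i).re) :
    ∫ φ, (∫ x, g x ∂(φ : Measure ℝ))⁻¹ ∂D = exp (-∫ x, log (g x) ∂α) := by
  have hb : ∀ i, 0 < α.real (C i) := fun i => ENNReal.toReal_pos (h0 i) (measure_ne_top _ _)
  have hVm : Measurable fun φ : ProbabilityMeasure ℝ =>
      fun i : Fin n => (φ : Measure ℝ).real (C i.castSucc) :=
    measurable_pi_iff.2 fun i => measurable_probabilityMeasure_real (hm _)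
  rw [integral_of_partition hm hd hu α (c := fun i => log (c i))
      (fun i x hx => by rw [hg i x hx]),
    ← integral_dirichletMeasure_inv hb (sum_real_partition hm hd hu α) hc,
    ← hD.map_partition n C hm hd hu h0, integral_map hVm.aemeasurable (by fun_prop)]
  refine integral_congr_ae (ae_of_all _ fun φ => ?_)
  dsimp only
  rw [integral_of_partition hm hd hu _ hg]
  congr 1
  refine Finset.sum_congr rfl fun i _ => ?_
  rw [simplexCoord_real_partition hm hd hu, mul_comm]

/-- The Markov–Krein identity for the integral of a simple function against a Dirichlet process. -/
theorem IsDirichletProcess.integral_inv_simpleFunc (hD : IsDirichletProcess α D)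
    (g : SimpleFunc ℝ ℂ) (hg : ∀ x, 0 < (g x).re) :
    ∫ φ, (∫ x, g x ∂(φ : Measure ℝ))⁻¹ ∂D = exp (-∫ x, log (g x) ∂α) := by
  classical
  -- The Dirichlet marginals are prescribed only for cells of positive mass. Only the values taken
  -- with positive mass are kept; `r` below sends all others to one of them, which changes `g` only
  -- on a null set.
  set S : Finset ℂ := g.range.filter fun c => α (g ⁻¹' {c}) ≠ 0 with hS
  have hgm : ∀ A : Set ℂ, MeasurableSet (g ⁻¹' A) := fun A => g.measurableSet_preimage A
  set N : Set ℝ := g ⁻¹' (S : Set ℂ)ᶜ with hN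
  have hN0 : α N = 0 := by
    have h1 : N ⊆ ⋃ c ∈ g.range.filter fun c => α (g ⁻¹' {c}) = 0, g ⁻¹' {c} := by
      intro x hx
      have hx' : g x ∉ S := hx
      simp only [hS, Finset.mem_filter, not_and, not_not] at hx'
      exact Set.mem_biUnion (x := g x)
        (Finset.mem_coe.2 (Finset.mem_filter.2 ⟨g.mem_range_self x, hx' (g.mem_range_self x)⟩)) rfl
    refine measure_mono_null h1 ((measure_biUnion_null_iff (Finset.countable_toSet _)).2 ?_)
    intro c hc
    exact (Finset.mem_filter.1 hc).2
  have hSne : S.Nonempty := by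
    by_contra h
    rw [Finset.not_nonempty_iff_eq_empty] at h
    simp [hN, h] at hN0
  obtain ⟨n, hn⟩ : ∃ n, S.card = n + 1 := ⟨S.card - 1, by have := hSne.card_pos; omega⟩
  let e : Fin (n + 1) ≃ S := (S.equivFinOfCardEq hn).symm
  obtain ⟨c₀, hc₀⟩ := hSne
  let r : ℂ → ℂ := fun z => if z ∈ S then z else c₀
  have hrS : ∀ z, r z ∈ S := by
    intro z
    simp only [r]
    split_ifs with h
    exacts [h, hc₀]
  have hr : ∀ x, x ∉ N → r (g x) = g x := fun x hx => if_pos (by simpa [hN] using hx)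
  have hae : ∀ᵐ φ : ProbabilityMeasure ℝ ∂D,
      ∫ x, g x ∂(φ : Measure ℝ) = ∫ x, r (g x) ∂(φ : Measure ℝ) := by
    filter_upwards [hD.ae_null N (hgm _) hN0] with φ hφ
    refine integral_congr_ae ?_
    filter_upwards [measure_eq_zero_iff_ae_notMem.1 hφ] with x hx
    rw [hr x hx]
  have hae' : ∫ x, log (g x) ∂α = ∫ x, log (r (g x)) ∂α := by
    refine integral_congr_ae ?_
    filter_upwards [measure_eq_zero_iff_ae_notMem.1 hN0] with x hx
    rw [hr x hx]
  rw [hae', integral_congr_ae (hae.mono fun φ hφ => by rw [hφ])]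
  refine hD.integral_inv_partition (C := fun i => g ⁻¹' (r ⁻¹' {(e i : ℂ)}))
    (c := fun i => (e i : ℂ)) (fun i => hgm _) ?_ ?_ (fun i => ?_) (fun i x hx => hx) (fun i => ?_)
  · intro i j hij
    refine Set.disjoint_left.2 fun x hxi hxj => hij (e.injective (Subtype.ext ?_))
    exact (Set.mem_singleton_iff.1 hxi).symm.trans (Set.mem_singleton_iff.1 hxj)
  · refine Set.eq_univ_of_forall fun x => Set.mem_iUnion.2 ⟨e.symm ⟨r (g x), hrS _⟩, ?_⟩
    simp
  · have hi := (Finset.mem_filter.1 (e i).2).2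
    refine fun h => hi (measure_mono_null (fun x hx => ?_) h)
    have hx' : g x = e i := hx
    have : r (g x) = e i := by rw [hx']; exact if_pos (e i).2
    exact this
  · obtain ⟨x, hx⟩ := SimpleFunc.mem_range.1 (Finset.mem_filter.1 (e i).2).1
    rw [← hx]
    exact hg x

lemma measurable_integral_simpleFunc (f : SimpleFunc ℝ ℝ) :
    Measurable fun φ : ProbabilityMeasure ℝ => ∫ x, f x ∂(φ : Measure ℝ) := by
  have h : ∀ φ : ProbabilityMeasure ℝ, ∫ x, f x ∂(φ : Measure ℝ) =
      ∑ y ∈ f.range, (φ : Measure ℝ).real (f ⁻¹' {y}) • y := fun φ =>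
    SimpleFunc.integral_eq_sum f (SimpleFunc.integrable_of_isFiniteMeasure f)
  simp_rw [h]
  refine Finset.measurable_fun_sum _ fun y _ => ?_
  exact (measurable_probabilityMeasure_real (f.measurableSet_preimage _)).smul_const y

/-- The Laplace-type form of the Markov–Krein identity for a nonnegative simple function. -/
lemma IsDirichletProcess.integral_inv_one_add (hD : IsDirichletProcess α D) (f : SimpleFunc ℝ ℝ)
    (hf0 : ∀ x, 0 ≤ f x) {s : ℝ} (hs : 0 ≤ s) :
    ∫ φ, (1 + s * ∫ x, f x ∂(φ : Measure ℝ))⁻¹ ∂D =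
      Real.exp (-∫ x, Real.log (1 + s * f x) ∂α) := by
  have h := hD.integral_inv_simpleFunc (f.map fun y => ((1 + s * y : ℝ) : ℂ)) (fun x => by
    simp only [SimpleFunc.coe_map, Function.comp_apply, ofReal_re]
    have := mul_nonneg hs (hf0 x)
    linarith)
  have h1 : ∀ φ : ProbabilityMeasure ℝ, ∫ x, ((1 + s * f x : ℝ) : ℂ) ∂(φ : Measure ℝ) =
      ((1 + s * ∫ x, f x ∂(φ : Measure ℝ) : ℝ) : ℂ) := by
    intro φ
    rw [integral_complex_ofReal, integral_add (integrable_const _)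
      ((SimpleFunc.integrable_of_isFiniteMeasure f).const_mul s), integral_const_mul]
    simp
  have h2 : ∀ x, log ((1 + s * f x : ℝ) : ℂ) = (Real.log (1 + s * f x) : ℝ) := by
    intro x
    rw [ofReal_log]
    have := mul_nonneg hs (hf0 x)
    linarith
  simp only [SimpleFunc.coe_map, Function.comp_apply, h1, h2, integral_complex_ofReal] at h
  rw [← ofReal_inj, ← integral_complex_ofReal]
  simpa using h

/-- Almost every realization of the Dirichlet process integrates `f` as soon as the parameter
integrates `log (1 + f)`. -/
theorem IsDirichletProcess.ae_lintegral_lt_top (hD : IsDirichletProcess α D) {f : ℝ → ℝ}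
    (hf : Measurable f) (hf0 : ∀ x, 0 ≤ f x)
    (hlog : Integrable (fun x => Real.log (1 + f x)) α) :
    ∀ᵐ φ : ProbabilityMeasure ℝ ∂D, ∫⁻ x, ENNReal.ofReal (f x) ∂(φ : Measure ℝ) < ⊤ := by
  have := hD.isProbabilityMeasure
  have hfe : Measurable fun x => ENNReal.ofReal (f x) := hf.ennreal_ofReal
  set g : ℕ → SimpleFunc ℝ ℝ := fun n =>
    (SimpleFunc.eapprox (fun x => ENNReal.ofReal (f x)) n).map ENNReal.toReal with hg
  have hgof : ∀ n x, ENNReal.ofReal (g n x) =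
      SimpleFunc.eapprox (fun x => ENNReal.ofReal (f x)) n x := fun n x =>
    ENNReal.ofReal_toReal (SimpleFunc.eapprox_lt_top _ n x).ne
  have hg0 : ∀ n x, 0 ≤ g n x := fun n x => ENNReal.toReal_nonneg
  have hgf : ∀ n x, g n x ≤ f x := by
    intro n x
    refine ENNReal.toReal_le_of_le_ofReal (hf0 x) ?_
    rw [← SimpleFunc.iSup_eapprox_apply hfe x]
    exact le_iSup (fun k => SimpleFunc.eapprox (fun x => ENNReal.ofReal (f x)) k x) n
  set a : ℕ → ProbabilityMeasure ℝ → ℝ := fun n φ => ∫ x, g n x ∂(φ : Measure ℝ) with ha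
  have ha0 : ∀ n φ, 0 ≤ a n φ := fun n φ => integral_nonneg (hg0 n)
  set A : Set (ProbabilityMeasure ℝ) :=
    {φ | ∫⁻ x, ENNReal.ofReal (f x) ∂(φ : Measure ℝ) < ⊤} with hA
  have hAm : MeasurableSet A :=
    ((Measure.measurable_lintegral hfe).comp measurable_subtype_coe) measurableSet_Iio
  have hlim : ∀ φ, φ ∉ A → Tendsto (fun n => a n φ) atTop atTop := by
    intro φ hφ
    have hφ' : ∫⁻ x, ENNReal.ofReal (f x) ∂(φ : Measure ℝ) = ⊤ := by simpa [hA] using hφ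
    rw [← ENNReal.tendsto_ofReal_nhds_top, ← hφ']
    have h1 : ∀ n, ENNReal.ofReal (a n φ) =
        ∫⁻ x, SimpleFunc.eapprox (fun x => ENNReal.ofReal (f x)) n x ∂(φ : Measure ℝ) := by
      intro n
      rw [ha, ofReal_integral_eq_lintegral_ofReal (SimpleFunc.integrable_of_isFiniteMeasure _)
        (ae_of_all _ (hg0 n))]
      simp_rw [hgof]
    simp_rw [h1]
    refine lintegral_tendsto_of_tendsto_of_monotone (fun n => (SimpleFunc.measurable _).aemeasurable)
      (ae_of_all _ fun x => fun i j hij => SimpleFunc.monotone_eapprox _ hij x)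
      (ae_of_all _ fun x => ?_)
    rw [← SimpleFunc.iSup_eapprox_apply hfe x]
    exact tendsto_atTop_iSup fun i j hij => SimpleFunc.monotone_eapprox _ hij x
  -- Off `A` the approximating integrals tend to infinity, so in the limit `(1 + s * a n φ)⁻¹`
  -- contributes only on `A`, where it is at most `1`. Letting `s → 0` afterwards gives `D.real A =
  -- 1`.
  have hkey : ∀ s : ℝ, 0 < s → Real.exp (-∫ x, Real.log (1 + s * f x) ∂α) ≤ D.real A := by
    intro s hs
    have hlogs : Integrable (fun x => Real.log (1 + s * f x)) α := by
      refine ((integrable_const (Real.log (1 + s))).add hlog).mono'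
        (Real.measurable_log.comp (by fun_prop)).aestronglyMeasurable (ae_of_all _ fun x => ?_)
      have h2 : 0 ≤ s * f x := mul_nonneg hs.le (hf0 x)
      rw [Real.norm_of_nonneg (Real.log_nonneg (by linarith)), Pi.add_apply,
        ← Real.log_mul (by positivity) (by linarith [hf0 x])]
      exact Real.log_le_log (by linarith) (by nlinarith [hf0 x])
    have hle : ∀ n, Real.exp (-∫ x, Real.log (1 + s * f x) ∂α) ≤
        D.real A + ∫ φ, Aᶜ.indicator (fun φ => (1 + s * a n φ)⁻¹) φ ∂D := by
      intro n
      have h1 : ∀ φ, (1 + s * a n φ)⁻¹ ≤ 1 := fun φ =>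
        inv_le_one_of_one_le₀ (by linarith [mul_nonneg hs.le (ha0 n φ)])
      have h0 : ∀ φ, 0 ≤ (1 + s * a n φ)⁻¹ := fun φ =>
        inv_nonneg.2 (by linarith [mul_nonneg hs.le (ha0 n φ)])
      have hmeas : Measurable fun φ => (1 + s * a n φ)⁻¹ :=
        ((measurable_integral_simpleFunc (g n)).const_mul s |>.const_add 1).inv
      have hint : Integrable (fun φ => (1 + s * a n φ)⁻¹) D :=
        Integrable.of_bound hmeas.aestronglyMeasurable 1 (ae_of_all _ fun φ => by
          rw [Real.norm_of_nonneg (h0 φ)]; exact h1 φ)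
      calc Real.exp (-∫ x, Real.log (1 + s * f x) ∂α)
          ≤ Real.exp (-∫ x, Real.log (1 + s * g n x) ∂α) := by
            refine Real.exp_le_exp.2 (neg_le_neg ?_)
            refine integral_mono_of_nonneg (ae_of_all _ fun x => ?_) hlogs
              (ae_of_all _ fun x => ?_)
            · exact Real.log_nonneg (by linarith [mul_nonneg hs.le (hg0 n x)])
            · exact Real.log_le_log (by linarith [mul_nonneg hs.le (hg0 n x)])
                (by nlinarith [hgf n x])
        _ = ∫ φ, (1 + s * a n φ)⁻¹ ∂D := (hD.integral_inv_one_add (g n) (hg0 n) hs.le).symm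
        _ ≤ ∫ φ, (A.indicator (fun _ => (1 : ℝ)) φ + Aᶜ.indicator (fun φ => (1 + s * a n φ)⁻¹) φ) ∂D := by
            refine integral_mono hint (((integrable_const (1 : ℝ)).indicator hAm).add
              (hint.indicator hAm.compl)) fun φ => ?_
            by_cases hφ : φ ∈ A <;> simp [hφ, h1]
        _ = _ := by
            rw [integral_add ((integrable_const (1 : ℝ)).indicator hAm)
              (hint.indicator hAm.compl), integral_indicator_const _ hAm, smul_eq_mul, mul_one]
    have hlim0 : Tendsto (fun n => ∫ φ, Aᶜ.indicator (fun φ => (1 + s * a n φ)⁻¹) φ ∂D) atTop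
        (𝓝 (∫ _, (0 : ℝ) ∂D)) := by
      refine tendsto_integral_of_dominated_convergence (fun _ => 1) (fun n => ?_)
        (integrable_const _) (fun n => ae_of_all _ fun φ => ?_) (ae_of_all _ fun φ => ?_)
      · exact (((measurable_integral_simpleFunc (g n)).const_mul s |>.const_add 1).inv.indicator
          hAm.compl).aestronglyMeasurable
      · have h2 : 1 ≤ 1 + s * a n φ := by linarith [mul_nonneg hs.le (ha0 n φ)]
        refine (norm_indicator_le_norm_self _ _).trans ?_
        rw [Real.norm_of_nonneg (inv_nonneg.2 (by linarith))]
        exact inv_le_one_of_one_le₀ h2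
      · by_cases hφ : φ ∈ A
        · simp [hφ]
        · simp only [Set.indicator_of_mem (Set.mem_compl hφ)]
          exact (tendsto_atTop_add_const_left _ 1
            ((hlim φ hφ).const_mul_atTop hs)).inv_tendsto_atTop
    have := ge_of_tendsto' (hlim0.const_add (D.real A)) hle
    simpa using this
  have h1 : Tendsto (fun k : ℕ =>
      Real.exp (-∫ x, Real.log (1 + 1 / ((k : ℝ) + 1) * f x) ∂α)) atTop (𝓝 1) := by
    have := (Real.continuous_exp.tendsto _).comp (tendsto_integral_log_one_add_mul hf hf0 hlog).neg
    simpa [Function.comp_def] using this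
  have h2 : D.real A = 1 :=
    le_antisymm measureReal_le_one (le_of_tendsto' h1 fun k => hkey _ (by positivity))
  have h3 : D A = 1 := by
    rw [Measure.real, ENNReal.toReal_eq_one_iff] at h2
    exact h2
  exact (mem_ae_iff_prob_eq_one hAm).2 h3

lemma IsDirichletProcess.ae_integrable_id (hD : IsDirichletProcess α D)
    (hlog : Integrable (fun x : ℝ => Real.log (1 + |x|)) α) :
    ∀ᵐ φ : ProbabilityMeasure ℝ ∂D, Integrable (fun x : ℝ => x) (φ : Measure ℝ) := by
  filter_upwards [hD.ae_lintegral_lt_top (f := fun x => |x|) (by fun_prop) abs_nonneg hlog]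
    with φ hφ
  refine ⟨by fun_prop, ?_⟩
  rw [hasFiniteIntegral_iff_norm]
  simpa using hφ

/-- Simple functions converging to the identity. -/
noncomputable def idApprox (n : ℕ) : SimpleFunc ℝ ℝ :=
  SimpleFunc.approxOn (fun x : ℝ => x) measurable_id Set.univ 0 (Set.mem_univ 0) n

lemma tendsto_idApprox (x : ℝ) : Tendsto (fun n => idApprox n x) atTop (𝓝 x) :=
  SimpleFunc.tendsto_approxOn measurable_id (Set.mem_univ 0) (by simp)

lemma abs_idApprox_le (n : ℕ) (x : ℝ) : |idApprox n x| ≤ |x| + |x| :=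
  SimpleFunc.norm_approxOn_zero_le measurable_id (Set.mem_univ 0) x n

lemma tendsto_integral_idApprox {ν : Measure ℝ} (h : Integrable (fun x : ℝ => x) ν) :
    Tendsto (fun n => ∫ x, idApprox n x ∂ν) atTop (𝓝 (∫ x, x ∂ν)) :=
  tendsto_integral_of_dominated_convergence (fun x => |x| + |x|)
    (fun n => (idApprox n).aestronglyMeasurable) (h.abs.add h.abs)
    (fun n => ae_of_all _ fun x => abs_idApprox_le n x) (ae_of_all _ tendsto_idApprox)

/-- The Bochner integral takes a default value at non-integrable realizations; these form a null
set, off which the mean is a limit of measurable functions. -/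
lemma IsDirichletProcess.aemeasurable_mean (hD : IsDirichletProcess α D)
    (hlog : Integrable (fun x : ℝ => Real.log (1 + |x|)) α) :
    AEMeasurable (fun φ : ProbabilityMeasure ℝ => ∫ x, x ∂(φ : Measure ℝ)) D :=
  aemeasurable_of_tendsto_metrizable_ae atTop
    (fun n => (measurable_integral_simpleFunc (idApprox n)).aemeasurable)
    ((hD.ae_integrable_id hlog).mono fun _ hφ => tendsto_integral_idApprox hφ)

/-- The **Markov–Krein identity** for the mean of a Dirichlet process. -/
theorem IsDirichletProcess.integral_inv_mean (hD : IsDirichletProcess α D)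
    (hlog : Integrable (fun x : ℝ => Real.log (1 + |x|)) α) {w : ℂ} (hw : 0 < w.re) :
    ∫ φ, (w + (∫ x, x ∂(φ : Measure ℝ) : ℝ) * I)⁻¹ ∂D = exp (-logPotential α w) := by
  have := hD.isProbabilityMeasure
  have h1 : ∀ n, ∫ φ, (w + (∫ x, idApprox n x ∂(φ : Measure ℝ) : ℝ) * I)⁻¹ ∂D =
      exp (-∫ x, log (w + idApprox n x * I) ∂α) := by
    intro n
    have h := hD.integral_inv_simpleFunc ((idApprox n).map fun y : ℝ => w + y * I)
      (fun x => by simpa using hw)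
    simp only [SimpleFunc.coe_map, Function.comp_apply] at h
    rw [← h]
    refine integral_congr_ae (ae_of_all _ fun φ => ?_)
    have hi : Integrable (fun x => (idApprox n x : ℂ) * I) (φ : Measure ℝ) :=
      (SimpleFunc.integrable_of_isFiniteMeasure (idApprox n)).ofReal.mul_const I
    dsimp only
    rw [integral_add (integrable_const _) hi, integral_mul_const,
      integral_complex_ofReal]
    simp
  have h2 : Tendsto (fun n => ∫ φ, (w + (∫ x, idApprox n x ∂(φ : Measure ℝ) : ℝ) * I)⁻¹ ∂D) atTop
      (𝓝 (∫ φ, (w + (∫ x, x ∂(φ : Measure ℝ) : ℝ) * I)⁻¹ ∂D)) := by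
    refine tendsto_integral_of_dominated_convergence (fun _ => w.re⁻¹) (fun n => ?_)
      (integrable_const _) (fun n => ae_of_all _ fun φ => norm_inv_add_mul_I_le hw _) ?_
    · have hm := measurable_integral_simpleFunc (idApprox n)
      exact (((measurable_ofReal.comp hm).mul_const I).const_add w).inv.aestronglyMeasurable
    · filter_upwards [hD.ae_integrable_id hlog] with φ hφ
      have h3 := (continuous_ofReal.tendsto _).comp (tendsto_integral_idApprox hφ)
      exact ((h3.mul_const I).const_add w).inv₀ (add_mul_I_ne_zero hw _)
  have h4 : Tendsto (fun n => exp (-∫ x, log (w + idApprox n x * I) ∂α)) atTop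
      (𝓝 (exp (-logPotential α w))) := by
    refine (continuous_exp.tendsto _).comp (Tendsto.neg ?_)
    -- The term `Real.log 2` absorbs the bound `2 |x|` on the approximants, as `1 + 2 |x| ≤ 2 (1 +
    -- |x|)`.
    refine tendsto_integral_of_dominated_convergence (fun x =>
      (|Real.log w.re| + Real.log (1 + ‖w‖) + Real.pi) + (Real.log 2 + Real.log (1 + |x|)))
      (fun n => ?_) ((integrable_const _).add ((integrable_const _).add hlog))
      (fun n => ae_of_all _ fun x => ?_) (ae_of_all _ fun x => ?_)
    · exact ((measurable_log_add_mul_I w).comp (idApprox n).measurable).aestronglyMeasurable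
    · refine (norm_log_add_mul_I_le hw (abs_idApprox_le n x)).trans ?_
      have hx := abs_nonneg x
      rw [← Real.log_mul two_ne_zero (by positivity)]
      gcongr
      linarith
    · have h3 := (continuous_ofReal.tendsto _).comp (tendsto_idApprox x)
      exact ((h3.mul_const I).const_add w).clog (add_mul_I_mem_slitPlane hw x)
  simp_rw [h1] at h2
  exact tendsto_nhds_unique h2 h4

end Transform

/-! ### The law of the mean: injectivity and fixed points. -/

lemma mem_paramClass_one_iff {α : Measure ℝ} : α ∈ paramClass 1 ↔
    IsProbabilityMeasure α ∧ Integrable (fun x : ℝ => Real.log (1 + |x|)) α := by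
  have hm : Measurable fun x : ℝ => Real.log (1 + |x|) := Real.measurable_log.comp (by fun_prop)
  have h0 : ∀ x : ℝ, 0 ≤ Real.log (1 + |x|) := fun x =>
    Real.log_nonneg (by linarith [abs_nonneg x])
  rw [paramClass, Set.mem_ofPred_eq, ENNReal.ofReal_one, isProbabilityMeasure_iff, Integrable,
    and_iff_right hm.aestronglyMeasurable, hasFiniteIntegral_iff_ofReal (ae_of_all _ h0)]

section Mean

variable {α : Measure ℝ} [IsProbabilityMeasure α]

lemma isProbabilityMeasure_meanLaw (hlog : Integrable (fun x : ℝ => Real.log (1 + |x|)) α) :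
    IsProbabilityMeasure (meanLaw α) := by
  have hD := isDirichletProcess_dirichletProcess α
  have := hD.isProbabilityMeasure
  exact Measure.isProbabilityMeasure_map (hD.aemeasurable_mean hlog)

theorem stieltjesRight_meanLaw (hlog : Integrable (fun x : ℝ => Real.log (1 + |x|)) α) {w : ℂ}
    (hw : 0 < w.re) : stieltjesRight (meanLaw α) w = exp (-logPotential α w) := by
  have hD := isDirichletProcess_dirichletProcess α
  rw [stieltjesRight, meanLaw, integral_map (hD.aemeasurable_mean hlog) (by fun_prop),
    hD.integral_inv_mean hlog hw]

lemma hasDerivAt_exp_logPotential (hlog : Integrable (fun x : ℝ => Real.log (1 + |x|)) α) {w : ℂ}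
    (hw : 0 < w.re) : HasDerivAt (fun w => exp (logPotential α w))
      (exp (logPotential α w) * stieltjesRight α w) w :=
  (hasDerivAt_logPotential hlog hw).cexp

/-- The parameter is determined by the law of the mean. -/
theorem injOn_meanLaw : Set.InjOn meanLaw (paramClass 1) := by
  intro α hα α' hα' h
  obtain ⟨_, hlog⟩ := mem_paramClass_one_iff.1 hα
  obtain ⟨_, hlog'⟩ := mem_paramClass_one_iff.1 hα'
  have hexp : ∀ w : ℂ, 0 < w.re → exp (logPotential α w) = exp (logPotential α' w) := by
    intro w hw
    have h1 := stieltjesRight_meanLaw hlog hw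
    rw [h, stieltjesRight_meanLaw hlog' hw, Complex.exp_neg, Complex.exp_neg] at h1
    exact (inv_injective h1).symm
  refine ext_of_stieltjesRight fun w hw => ?_
  have h1 := hasDerivAt_exp_logPotential hlog hw
  have h2 := (hasDerivAt_exp_logPotential hlog' hw).congr_of_eventuallyEq
    (eventuallyEq_of_mem (isOpen_rightHalfPlane.mem_nhds hw) fun z hz => hexp z hz)
  have h3 := h1.unique h2
  rw [hexp w hw] at h3
  exact mul_left_cancel₀ (Complex.exp_ne_zero _) h3

lemma exists_cauchyMeasure_of_meanLaw_eq
    (hlog : Integrable (fun x : ℝ => Real.log (1 + |x|)) α) (h : meanLaw α = α) :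
    ∃ (θ : ℝ) (γ : ℝ≥0), α = cauchyMeasure θ γ := by
  have hT : ∀ w : ℂ, 0 < w.re → stieltjesRight α w = exp (-logPotential α w) := by
    intro w hw
    rw [← stieltjesRight_meanLaw hlog hw, h]
  set c : ℂ := exp (logPotential α 1) - 1 with hc
  -- At a fixed point `exp Λ` has derivative `exp Λ · exp (-Λ) = 1`.
  have hE : ∀ w : ℂ, 0 < w.re → exp (logPotential α w) = w + c := by
    intro w hw
    have h1 : ∀ z : ℂ, 0 < z.re → HasDerivAt (fun z => exp (logPotential α z) - z) 0 z := by
      intro z hz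
      refine ((hasDerivAt_exp_logPotential hlog hz).sub (hasDerivAt_id z)).congr_deriv ?_
      rw [hT z hz, ← Complex.exp_add]
      simp
    have h2 := eq_of_hasDerivAt_zero h1 hw (z := 1) (by simp)
    rw [hc]
    linear_combination h2
  -- Otherwise `-c` would lie in the half-plane and be a zero of an exponential.
  have hc0 : 0 ≤ c.re := by
    by_contra! hneg
    have h1 := hE (-c) (by simpa using hneg)
    rw [neg_add_cancel] at h1
    exact Complex.exp_ne_zero _ h1
  refine ⟨c.im, c.re.toNNReal, ext_of_stieltjesRight fun w hw => ?_⟩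
  rw [hT w hw, stieltjesRight_cauchyMeasure _ _ hw, Complex.exp_neg, hE w hw,
    Real.coe_toNNReal _ hc0, add_assoc, re_add_im]

/-- The transform `S = 1 / (z + γ + iθ)` satisfies `S' = -S²`, the differential equation of
`stieltjesRight_eq_exp_neg_logPotential` with both measures equal. -/
lemma meanLaw_cauchyMeasure (θ : ℝ) (γ : ℝ≥0) :
    meanLaw (cauchyMeasure θ γ) = cauchyMeasure θ γ := by
  have hlog := integrable_log_cauchyMeasure θ γ
  have := isProbabilityMeasure_meanLaw hlog
  refine ext_of_stieltjesRight fun w hw => ?_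
  rw [stieltjesRight_meanLaw hlog hw]
  refine (stieltjesRight_eq_exp_neg_logPotential hlog (fun z hz => ?_) hw).symm
  have hne : z + γ + θ * I ≠ 0 :=
    add_mul_I_ne_zero (w := z + γ) (by simpa using add_pos_of_pos_of_nonneg hz γ.2) θ
  have h1 : HasDerivAt (fun z : ℂ => (z + γ + θ * I)⁻¹) (-1 / (z + γ + θ * I) ^ 2) z :=
    ((((hasDerivAt_id z).add_const (γ : ℂ)).add_const (θ * I : ℂ)).fun_inv hne)
  have h2 := (hasDerivAt_stieltjesRight (μ := cauchyMeasure θ γ) hz).congr_of_eventuallyEq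
    (eventuallyEq_of_mem (isOpen_rightHalfPlane.mem_nhds hz) fun y hy =>
      (stieltjesRight_cauchyMeasure θ γ hy).symm)
  have h3 := h2.unique h1
  rw [stieltjesRight_cauchyMeasure θ γ hz, neg_eq_iff_eq_neg.1 h3]
  field_simp

lemma cauchyMeasure_mem_paramClass (θ : ℝ) (γ : ℝ≥0) : cauchyMeasure θ γ ∈ paramClass 1 :=
  mem_paramClass_one_iff.2 ⟨inferInstance, integrable_log_cauchyMeasure θ γ⟩

lemma meanLaw_eq_self_iff {α : Measure ℝ} (hα : α ∈ paramClass 1) :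
    meanLaw α = α ↔ ∃ (θ : ℝ) (γ : ℝ≥0), α = cauchyMeasure θ γ := by
  obtain ⟨_, hlog⟩ := mem_paramClass_one_iff.1 hα
  refine ⟨exists_cauchyMeasure_of_meanLaw_eq hlog, ?_⟩
  rintro ⟨θ, γ, rfl⟩
  exact meanLaw_cauchyMeasure θ γ

end Mean

lemma exists_cauchyLaw_iff {μ : Measure ℝ} :
    (∃ (θ : ℝ) (v : ℝ≥0∞), 0 < v ∧ μ = cauchyLaw θ v) ↔
      ∃ (θ : ℝ) (γ : ℝ≥0), μ = cauchyMeasure θ γ := by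
  constructor
  · rintro ⟨θ, v, -, rfl⟩
    by_cases hv : v = ⊤
    · exact ⟨θ, 0, by simp [cauchyLaw, hv]⟩
    · exact ⟨θ, _, by rw [cauchyLaw, if_neg hv]⟩
  · rintro ⟨θ, γ, rfl⟩
    obtain rfl | hγ := eq_or_ne γ 0
    · exact ⟨θ, ⊤, by simp, by simp [cauchyLaw]⟩
    -- The scale is `γ = 1 / σ`, hence `σ² = γ⁻²`; scale zero corresponds to `σ² = ∞`.
    · refine ⟨θ, ((γ⁻¹ ^ 2 : ℝ≥0) : ℝ≥0∞), ?_, ?_⟩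
      · rw [ENNReal.coe_pos]
        exact pow_pos (inv_pos.2 (pos_iff_ne_zero.2 hγ)) 2
      · rw [cauchyLaw, if_neg ENNReal.coe_ne_top, ENNReal.toNNReal_coe, NNReal.sqrt_sq, inv_inv]

end DirichletMean

theorem theorem5 :
    Set.BijOn (DirichletMean.markovKrein 1)
        (DirichletMean.meanLawClass 1) (DirichletMean.paramClass 1) ∧
      {μ : Measure ℝ | μ ∈ DirichletMean.meanLawClass 1 ∧ DirichletMean.markovKrein 1 μ = μ} =
        {μ : Measure ℝ | ∃ (θ : ℝ) (v : ℝ≥0∞), 0 < v ∧ μ = DirichletMean.cauchyLaw θ v} ∧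
      ∀ α : Measure ℝ, α ∈ DirichletMean.paramClass 1 →
        (DirichletMean.meanLaw α = α ↔
          (∃ (θ : ℝ) (γ : ℝ≥0), γ ≠ 0 ∧ α = cauchyMeasure θ γ) ∨
            ∃ θ : ℝ, α = Measure.dirac θ) := by
  have hinj := DirichletMean.injOn_meanLaw
  have hbij : Set.BijOn DirichletMean.meanLaw (DirichletMean.paramClass 1)
      (DirichletMean.meanLawClass 1) := hinj.bijOn_image
  have hinv : ∀ α ∈ DirichletMean.paramClass 1,
      DirichletMean.markovKrein 1 (DirichletMean.meanLaw α) = α :=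
    fun α hα => hinj.leftInvOn_invFunOn hα
  refine ⟨hbij.symm hbij.invOn_invFunOn.symm, ?_, fun α hα => ?_⟩
  · ext μ
    simp only [Set.mem_ofPred_eq, DirichletMean.exists_cauchyLaw_iff]
    constructor
    · rintro ⟨⟨α, hα, rfl⟩, h⟩
      rw [hinv α hα] at h
      rw [← h]
      exact (DirichletMean.meanLaw_eq_self_iff hα).1 h.symm
    · rintro ⟨θ, γ, rfl⟩
      have hα := DirichletMean.cauchyMeasure_mem_paramClass θ γ
      have h := DirichletMean.meanLaw_cauchyMeasure θ γ
      -- A Cauchy law belongs to the class of mean laws because it is its own mean law.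
      refine ⟨⟨_, hα, h⟩, ?_⟩
      have h2 := hinv _ hα
      rwa [h] at h2
  · rw [DirichletMean.meanLaw_eq_self_iff hα]
    constructor
    · rintro ⟨θ, γ, rfl⟩
      obtain rfl | hγ := eq_or_ne γ 0
      · exact Or.inr ⟨θ, by simp⟩
      · exact Or.inl ⟨θ, γ, hγ, rfl⟩
    · rintro (⟨θ, γ, -, h⟩ | ⟨θ, h⟩)
      · exact ⟨θ, γ, h⟩
      · exact ⟨θ, 0, by simp [h]⟩
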